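/- Let $A$ be a non-empty recursive set (the alphabet), let $A^*$ be the set of all words (finite sequences of letters) over $A$, including the empty word $\emptyset$, and let $SF(A)$ be the set of square-free words, i.e. of those $w\in A^*$ such that $w=ussv$ with $u,s,v\in A^*$ implies $s=\emptyset$. A system of defining relations is an irreflexive binary relation $\pi$ on $A^*$. Write $x\stackrel{\pi}{\leftrightarrow}y$ if $x=rus$ and $y=rvs$ for some $r,s,u,v\in A^*$ with $(u,v)\in\pi$ or $(v,u)\in\pi$; let $\stackrel{\pi}{=}$ be the reflexive and transitive closure of $\stackrel{\pi}{\leftrightarrow}$, and let $[w]_\pi$ be the class of $w\in A^*$ under $\stackrel{\pi}{=}$. A word $w\in A^*$ is square-free relative to $\pi$ if $[w]_\pi\subseteq SF(A)$; the set of all such words is denoted $SF(A,\pi)$. Then for every system of two defining relations $\pi=\{(u_1,v_1),(u_2,v_2)\}$ (so $u_i,v_i\in A^*$ and $u_i\neq v_i$ for $i=1,2$; the two pairs may coincide) the problem of recognizing whether a given word is square-free relative to $\pi$ is algorithmically decidable, that is, the set $SF(A,\pi)$ is recursive. -/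

import Mathlib

/-- The set `A*` of all words (finite sequences of letters) over the alphabet `A`. -/
def wordsOver {α : Type*} (A : Set α) : Set (List α) :=
  {w | ∀ a ∈ w, a ∈ A}

/-- The set `SF(A)` of square-free words over `A`: words `w` such that `w = ussv` forces `s`
to be empty. -/
def squareFreeWords {α : Type*} (A : Set α) : Set (List α) :=
  {w | w ∈ wordsOver A ∧
    ∀ u ∈ wordsOver A, ∀ s ∈ wordsOver A, ∀ v ∈ wordsOver A, w = u ++ s ++ s ++ v → s = []}

/-- A system of defining relations over `A`: an irreflexive binary relation on `A*`. -/
structure IsDefiningSystem {α : Type*} (A : Set α) (π : Set (List α × List α)) : Prop where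
  words : ∀ u v, (u, v) ∈ π → u ∈ wordsOver A ∧ v ∈ wordsOver A
  irrefl : ∀ u, (u, u) ∉ π

/-- Direct derivability: `x = rus` and `y = rvs` for words `r, s, u, v` in `A*` with
`(u, v) ∈ π` or `(v, u) ∈ π`. -/
def DirectlyDerivable {α : Type*} (A : Set α) (π : Set (List α × List α))
    (x y : List α) : Prop :=
  ∃ r ∈ wordsOver A, ∃ s ∈ wordsOver A, ∃ u ∈ wordsOver A, ∃ v ∈ wordsOver A,
    x = r ++ u ++ s ∧ y = r ++ v ++ s ∧ ((u, v) ∈ π ∨ (v, u) ∈ π)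

/-- Equality relative to `π`: the reflexive and transitive closure of direct derivability. -/
def EqualRelativeTo {α : Type*} (A : Set α) (π : Set (List α × List α)) :
    List α → List α → Prop :=
  Relation.ReflTransGen (DirectlyDerivable A π)

/-- The class `[w]_π` of the words over `A` that are equal to `w` relative to `π`. -/
def relClass {α : Type*} (A : Set α) (π : Set (List α × List α)) (w : List α) :
    Set (List α) :=
  {x | x ∈ wordsOver A ∧ EqualRelativeTo A π w x}

/-- The set `SF(A, π)` of the words over `A` that are square-free relative to `π`. -/
def relSquareFreeWords {α : Type*} (A : Set α) (π : Set (List α × List α)) : Set (List α) :=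
  {w | w ∈ wordsOver A ∧ relClass A π w ⊆ squareFreeWords A}

/-- A recursive (computable) set. -/
def IsRecursiveSet {β : Type*} [Primcodable β] (S : Set β) : Prop :=
  ComputablePred fun b => b ∈ S

/-! The heart of the matter is that a class consisting of square-free words is finite
(`IsPresentation.finite_class_twoRel`). Breadth-first search from `w` then decides: it stops when it
meets a square or when it finds no new word, and one of the two must happen (`exists_searchDone`).

Finiteness is proved for two families `G a`, `G (!a)` of mutually equal words, in the quotient
monoid, under axioms called tameness. Square-freeness makes overlaps rigid: if a word `z` of a
family is followed by a nonempty suffix `g` of a word `z'` of the same family, replacing `z` by `z'`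
creates `gg`. Hence a class ending in a word of `G a` has words of only two shapes
(`IsTame.reach_cases`): the final block is still there, or a word of `G (!a)` straddling its left
end has been rewritten and only a tail of a block remains. Letters are appended one at a time
(`IsTame.finite_class`); the hard case is appending a whole block (`IsTame.finite_append`), where
uniqueness of overlaps confines the prefixes to finitely many words.

Two relations become tame once the sides of one are closed under rewriting by the other
(`IsPresentation.isTame_saturated`), provided no word so obtained is a factor of a side of the other
relation. If this fails in both orders, then all four sides are equal in the quotient, or no side
occurs in a word of the class. -/

open Relation

/-! ### Tame presentations and the shapes of words in a square-free class. -/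

section Rewriting

variable {α M : Type*} [Monoid M]

/-- A word without a nonempty square factor. -/
def NoSquare (x : List α) : Prop :=
  ∀ p s q, x = p ++ s ++ s ++ q → s = []

/-- Replace one occurrence of a word of `G a` by another word of `G a`. -/
def RStep (G : Bool → Set (List α)) (x y : List α) : Prop :=
  ∃ a r s z z', z ∈ G a ∧ z' ∈ G a ∧ x = r ++ z ++ s ∧ y = r ++ z' ++ s

/-- All the words in the class `m` are square-free. -/
def SFClass (φ : List α → M) (m : M) : Prop :=
  ∀ x, φ x = m → NoSquare x

/-- `φ` is the quotient map of the congruence generated by `G`. -/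
structure IsPresentation (G : Bool → Set (List α)) (φ : List α → M) : Prop where
  nil : φ [] = 1
  append : ∀ x y, φ (x ++ y) = φ x * φ y
  eq_iff : ∀ x y, φ x = φ y ↔ ReflTransGen (RStep G) x y

/-- The two families of words interact in a controlled way. -/
structure IsTame (G : Bool → Set (List α)) (φ : List α → M) : Prop
    extends IsPresentation G φ where
  ne_nil : ∀ a z, z ∈ G a → z ≠ []
  -- A rewrite by one family inside a word of the other must not leave that family.
  replace : ∀ a s z z' t, s ++ z ++ t ∈ G a → z ∈ G (!a) → z' ∈ G (!a) →
    SFClass φ (φ (s ++ z ++ t)) → s ++ z' ++ t ∈ G a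
  -- A pigeonhole principle: among three overlaps of `G b` with `G (!b)`, two have the same common
  -- part. It will come from each family having only two sources.
  overlap : ∀ b d₁ c₁ e₁ d₂ c₂ e₂ d₃ c₃ e₃,
    d₁ ++ c₁ ∈ G b → c₁ ++ e₁ ∈ G (!b) → e₁ ≠ [] → SFClass φ (φ d₁ * φ c₁ * φ e₁) →
    d₂ ++ c₂ ∈ G b → c₂ ++ e₂ ∈ G (!b) → e₂ ≠ [] → SFClass φ (φ d₂ * φ c₂ * φ e₂) →
    d₃ ++ c₃ ∈ G b → c₃ ++ e₃ ∈ G (!b) → e₃ ≠ [] → SFClass φ (φ d₃ * φ c₃ * φ e₃) →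
    c₁ = c₂ ∨ c₁ = c₃ ∨ c₂ = c₃
  finite : ∀ a, {z | z ∈ G a ∧ SFClass φ (φ z)}.Finite

variable {G : Bool → Set (List α)} {φ : List α → M}

/-- Appending words of `G (!a)` and `G a` with a common part `k` to `x`. -/
def Adj (G : Bool → Set (List α)) (φ : List α → M) (a : Bool) (x k h : List α) : Prop :=
  ∃ u j, φ x = φ u * φ j ∧ j ≠ [] ∧ k ≠ [] ∧ h ≠ [] ∧ j ++ k ∈ G (!a) ∧ k ++ h ∈ G a

theorem NoSquare.of_append {p x s : List α} (h : NoSquare (p ++ x ++ s)) : NoSquare x := by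
  intro p' t q hx
  exact h (p ++ p') t (q ++ s) (by simp [hx])

theorem IsPresentation.sf_mid (S : IsPresentation G φ) {p s : List α} {m W : M}
    (hW : SFClass φ W) (e : W = φ p * m * φ s) : SFClass φ m := by
  intro x hx
  exact (hW (p ++ x ++ s) (by simp [S.append, hx, e, mul_assoc])).of_append

theorem IsPresentation.congr (S : IsPresentation G φ) {a : Bool} {z z' : List α}
    (hz : z ∈ G a) (hz' : z' ∈ G a) : φ z = φ z' :=
  (S.eq_iff _ _).2 (ReflTransGen.single ⟨a, [], [], z, z', hz, hz', by simp, by simp⟩)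

/-- Replacing `z` by `z' = m ++ g` in front of `g` produces the square `g ++ g`. With its mirror
image `not_prefix`, this is the source of nearly every contradiction below. -/
theorem IsPresentation.not_suffix (S : IsPresentation G φ) {a : Bool} {z z' m g : List α} {W : M}
    (hW : SFClass φ W) (hz : z ∈ G a) (hz' : z' ∈ G a) (hs : z' = m ++ g) (p s : List α)
    (e : W = φ p * φ z * φ g * φ s) : g = [] := by
  refine hW (p ++ z' ++ g ++ s) ?_ (p ++ m) g s (by simp [hs])
  simp only [S.append, e, S.congr hz hz']

theorem IsPresentation.not_prefix (S : IsPresentation G φ) {a : Bool} {z z' m g : List α} {W : M}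
    (hW : SFClass φ W) (hz : z ∈ G a) (hz' : z' ∈ G a) (hs : z' = g ++ m) (p s : List α)
    (e : W = φ p * φ g * φ z * φ s) : g = [] := by
  refine hW (p ++ g ++ z' ++ s) ?_ p g (m ++ s) (by simp [hs])
  simp only [S.append, e, S.congr hz hz']

/-- Induction along a derivation, with invariants `P` for the part before an intact final block and
`Q` for the part before a surviving tail `h`. A `G a`-rewrite touching the block must replace all of
it; a `G (!a)`-rewrite lies on one side of its left end or straddles it. The straddling rewrite
passes from the first shape to the second (`h2`), and a word of `G a` reappearing at the end leads
back (`h3`). `h1` excludes absorption of the whole block. -/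
theorem IsTame.reach_cases (S : IsTame G φ) {a : Bool} {W : M} (hW : SFClass φ W)
    {P Q : List α → Prop}
    (hP : ∀ x x', φ x = φ x' → P x → P x') (hQ : ∀ x x', φ x = φ x' → Q x → Q x')
    (h1 : ∀ r m z, P (r ++ m) → m ≠ [] → z ∈ G a → W = φ (r ++ m) * φ z →
      m ++ z ∈ G (!a) → False)
    (h2 : ∀ x k h, P x → W = φ x * φ k * φ h → Adj G φ a x k h → Q (x ++ k))
    (h3 : ∀ Y h x k r s, Q Y → Adj G φ a x k h → φ Y = φ x * φ k → W = φ Y * φ h →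
      Y ++ h = r ++ s → s ∈ G a → P r)
    {x₀ z₀ : List α} (hz₀ : z₀ ∈ G a) (hx₀ : W = φ x₀ * φ z₀) (hPx₀ : P x₀) :
    ∀ Y, φ Y = W → (∃ x z, z ∈ G a ∧ Y = x ++ z ∧ P x) ∨
      (∃ Y' h x k, Y = Y' ++ h ∧ Adj G φ a x k h ∧ φ Y' = φ x * φ k ∧ Q Y') := by
  intro Y hY
  have key : ReflTransGen (RStep G) (x₀ ++ z₀) Y :=
    (S.eq_iff _ _).1 (by rw [S.append, ← hx₀, hY])
  clear hY
  induction key with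
  | refl => exact Or.inl ⟨x₀, z₀, hz₀, rfl, hPx₀⟩
  | @tail Y Y₂ hst hs ih =>
    have hYW : W = φ Y := by rw [hx₀, ← S.append]; exact (S.eq_iff _ _).2 hst
    clear hst
    obtain ⟨c, r, t, s, s', hs, hs', rfl, rfl⟩ := hs
    have hss : φ s = φ s' := S.congr hs hs'
    have hca : c = a ∨ c = !a := by cases c <;> cases a <;> simp
    rcases ih with ⟨x, z, hz, hY, hPx⟩ | ⟨Y', h, x, k, hY, hadj, hY', hQY⟩
    · rw [hY, S.append] at hYW
      rcases List.append_eq_append_iff.1 hY with ⟨m, hx, ht⟩ | ⟨m, hm, hzm⟩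
      · refine Or.inl ⟨r ++ s' ++ m, z, hz, by simp [ht], hP _ _ ?_ hPx⟩
        simp [hx, S.append, hss]
      · have hxm : φ r * φ s = φ x * φ m := by rw [← S.append, ← S.append, hm]
        rcases hca with rfl | rfl
        · have ht : t = [] := S.not_suffix hW hs hz hzm r [] (by
            rw [hYW, hxm, hzm]; simp [S.append, S.nil, mul_assoc])
          subst ht
          simp only [List.append_nil] at hY hzm ⊢
          subst hzm
          have : r = x := by
            rcases List.append_eq_append_iff.1 hY with ⟨e, he, hse⟩ | ⟨e, he, hse⟩
            · have : e = [] := S.not_prefix hW hz hs hse r [] (by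
                rw [hYW, he]; simp [S.append, S.nil, mul_assoc])
              simp [he, this]
            · have : e = [] := S.not_prefix hW hs hz hse x [] (by
                rw [hYW, hse]; simp [S.append, S.nil, mul_assoc])
              simp [he, this]
          subst this
          exact Or.inl ⟨r, s', hs', rfl, hPx⟩
        · rcases List.append_eq_append_iff.1 hm with ⟨v, hv, hsv⟩ | ⟨v, hv, hsv⟩
          · by_cases hm0 : m = []
            · subst hm0
              simp only [List.append_nil] at hm hsv
              simp only [List.nil_append] at hzm
              subst hzm
              refine Or.inl ⟨r ++ s', z, hz, rfl, hP _ _ ?_ hPx⟩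
              rw [← hm]; simp [S.append, hss]
            by_cases hv0 : v = []
            · subst hv0
              simp only [List.append_nil, List.nil_append] at hv hsv
              subst hv hsv hzm
              refine Or.inl ⟨x, s' ++ t, ?_, by simp, hPx⟩
              simpa using S.replace a [] s s' t (by simpa using hz) hs hs'
                (S.sf_mid (p := x) (s := []) hW (by simpa [S.nil, S.append] using hYW))
            -- The rewritten word straddles the left end of the block: it either swallows the block
            -- or leaves the tail `t`.
            by_cases ht0 : t = []
            · subst ht0
              simp only [List.append_nil] at hzm
              subst hzm
              exact (h1 r v z (hv ▸ hPx) hv0 hz (hv ▸ hYW) (hsv ▸ hs)).elim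
            · have hadj : Adj G φ a x m t :=
                ⟨r, v, by rw [hv, S.append], hv0, hm0, ht0, hsv ▸ hs, hzm ▸ hz⟩
              refine Or.inr ⟨r ++ s', t, x, m, rfl, hadj, ?_, ?_⟩
              · rw [S.append, ← hss, hxm]
              · refine hQ _ _ ?_ (h2 x m t hPx ?_ hadj)
                · rw [S.append, S.append, ← hss, hxm]
                · rw [hYW, hzm, S.append, mul_assoc]
          · subst hv hsv hzm
            refine Or.inl ⟨x, v ++ s' ++ t, ?_, by simp, hPx⟩
            exact S.replace a v s s' t (by simpa using hz) hs hs'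
              (S.sf_mid (p := x) (s := []) hW (by simpa [S.nil, S.append] using hYW))
    · rw [hY, S.append] at hYW
      obtain ⟨u, j, hx, hj, hk, hh, hjk, hkh⟩ := id hadj
      rcases List.append_eq_append_iff.1 hY with ⟨m, hx', ht⟩ | ⟨m, hm, hzm⟩
      · refine Or.inr ⟨r ++ s' ++ m, h, x, k, by simp [ht], hadj, ?_, hQ _ _ ?_ hQY⟩
        · rw [← hY', hx']; simp [S.append, hss]
        · rw [hx']; simp [S.append, hss]
      · have hxm : φ r * φ s = φ Y' * φ m := by rw [← S.append, ← S.append, hm]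
        rcases hca with rfl | rfl
        · have ht : t = [] := S.not_suffix (z' := k ++ h) (m := k ++ m) hW hs hkh
            (by simp [hzm]) r [] (by
            rw [hYW, hxm, hzm]; simp [S.append, S.nil, mul_assoc])
          subst ht
          refine Or.inl ⟨r, s', hs', by simp, h3 Y' h x k r s hQY hadj hY' hYW ?_ hs⟩
          simpa using hY.symm
        · rcases List.append_eq_append_iff.1 hm with ⟨v, hv, hsv⟩ | ⟨v, hv, hsv⟩
          · have hm0 : m = [] := S.not_suffix (m := v) hW hjk hs hsv u t (by
              rw [hYW, hY', hx, hzm]; simp [S.append, mul_assoc])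
            subst hm0
            simp only [List.append_nil, List.nil_append] at hm hsv hzm
            subst hzm
            refine Or.inr ⟨r ++ s', h, x, k, rfl, hadj, ?_, hQ _ _ ?_ hQY⟩
            · rw [← hY', ← hm]; simp [S.append, hss]
            · rw [← hm]; simp [S.append, hss]
          · subst hv hsv hzm
            have h4 := S.replace a (k ++ v) s s' t (by simpa using hkh) hs hs'
              (S.sf_mid (p := x) (s := []) hW (by
                rw [hYW, hY']; simp [S.nil, S.append, mul_assoc]))
            refine Or.inr ⟨Y', v ++ s' ++ t, x, k, by simp, ⟨u, j, hx, hj, hk, ?_, hjk, ?_⟩,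
              hY', hQY⟩
            · have := S.ne_nil _ _ hs'
              simp [this]
            · simpa using h4

end Rewriting

/-! ### Comparison of overlaps at the end of a class. -/

section Rewriting

variable {α M : Type*} [Monoid M] {G : Bool → Set (List α)} {φ : List α → M}

theorem IsTame.cases_of_no_end (S : IsTame G φ) {a : Bool} {W : M} (hW : SFClass φ W)
    (hN : ∀ r s, s ∈ G (!a) → W ≠ φ r * φ s)
    {x₀ z₀ : List α} (hz₀ : z₀ ∈ G a) (hx₀ : W = φ x₀ * φ z₀) (Y : List α) (hY : φ Y = W) :
    (∃ x z, z ∈ G a ∧ Y = x ++ z) ∨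
      (∃ Y' h x k, Y = Y' ++ h ∧ Adj G φ a x k h ∧ φ Y' = φ x * φ k) := by
  have := S.reach_cases hW (P := fun _ => True) (Q := fun _ => True)
    (fun _ _ _ h => h) (fun _ _ _ h => h) ?_ (fun _ _ _ _ _ _ => trivial)
    (fun _ _ _ _ _ _ _ _ _ _ _ _ => trivial) hz₀ hx₀ trivial Y hY
  · simpa using this
  · intro r m z _ _ _ hW' hm
    exact hN r (m ++ z) hm (by rw [hW']; simp [S.append, mul_assoc])

/-- Otherwise `s` could be replaced by `k ++ h` in front of `h`, giving `h ++ h`. -/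
theorem IsPresentation.no_end (S : IsPresentation G φ) {a : Bool} {W m : M} (hW : SFClass φ W)
    {k h : List α} (hh : h ≠ []) (hkh : k ++ h ∈ G a) (t : List α) (e : W = m * φ h * φ t) :
    ∀ r s, s ∈ G a → m ≠ φ r * φ s := by
  rintro r s hs rfl
  exact hh (S.not_suffix hW hs hkh rfl r t e)

/-- When a block reappears at the end, it reappears as an overlap with the same tail `h`. No word of
the class of `Y` ends in `G a`, so the two shapes for `G (!a)` apply to `r ++ k'`, and each yields a
word of `G (!a)`, up to equality of what precedes it, ending in `k'` and starting before it. -/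
theorem IsTame.adj_of_ends (S : IsTame G φ) {a : Bool} {W : M} (hW : SFClass φ W)
    {Y h x k r s : List α} (hadj : Adj G φ a x k h) (hY : φ Y = φ x * φ k)
    (hWY : W = φ Y * φ h) (hs : Y ++ h = r ++ s) (hsG : s ∈ G a) :
    ∃ k', Y = r ++ k' ∧ s = k' ++ h ∧ Adj G φ a r k' h := by
  obtain ⟨u, j, hx, hj, hk, hh, hjk, hkh⟩ := hadj
  have hle : ∀ m, h = m ++ s → False := fun m hm => by
    have := S.not_prefix (g := k ++ m) (m := s) hW hsG hkh (by simp [hm]) x [] (by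
      rw [hWY, hY, hm]; simp [S.append, S.nil, mul_assoc])
    simp [hk] at this
  rcases List.append_eq_append_iff.1 hs with ⟨m, hr, hm⟩ | ⟨k', hYk, hsk⟩
  · exact (hle m hm).elim
  refine ⟨k', hYk, hsk, ?_⟩
  have hk' : k' ≠ [] := by
    rintro rfl
    exact hle [] (by simpa using hsk.symm)
  have hYu : φ Y = φ u * φ (j ++ k) := by rw [hY, hx, S.append, mul_assoc]
  have hbad : ∀ k₁ V', V' ∈ G (!a) → k' = k₁ ++ V' → False := by
    intro k₁ V' hV' hk₁
    have hs' := S.replace a k₁ V' (j ++ k) h (by simpa [hk₁, hsk] using hsG) hV' hjk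
      (S.sf_mid (p := r) (s := []) hW (by
        rw [hWY, hYk, hk₁]; simp [S.append, S.nil, mul_assoc]))
    have := S.not_prefix (g := k₁ ++ j) (m := k ++ h) hW hkh hs' (by simp) r [] (by
      rw [hWY, hYk, hk₁, S.append, S.append, S.congr hV' hjk]
      simp [S.append, S.nil, mul_assoc])
    simp [hj] at this
  have hWY' : W = φ [] * φ Y * φ h := by rw [hWY, S.nil, one_mul]
  rcases S.cases_of_no_end (S.sf_mid hW hWY') (a := !a)
    (by
      simp only [Bool.not_not]
      exact S.no_end hW hh hkh [] (by rw [hWY, S.nil, mul_one]))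
    hjk hYu Y rfl with ⟨x', V', hV', hx'⟩ | ⟨Y', h', x₂, k₂, hY', ⟨u₂, t, hx₂, ht, hk₂, hh', htk, hkh'⟩, hYk'⟩
  · rw [hYk] at hx'
    rcases List.append_eq_append_iff.1 hx' with ⟨k₁, hrk, hkk⟩ | ⟨j', hxj, hkj⟩
    · exact (hbad k₁ V' hV' hkk).elim
    · by_cases hj' : j' = []
      · subst hj'
        exact (hbad [] V' hV' (by simpa using hkj.symm)).elim
      · exact ⟨x', j', by rw [hxj, S.append], hj', hk', hh, hkj ▸ hV', hsk ▸ hsG⟩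
  · rw [hYk] at hY'
    simp only [Bool.not_not] at htk
    rcases List.append_eq_append_iff.1 hY' with ⟨k₁, hrk, hkk⟩ | ⟨j', hxj, hkj⟩
    · have := S.not_suffix (g := h' ++ h) hW htk hsG (m := k₁) (by simp [hsk, hkk]) u₂ [] (by
        rw [hWY, hYk, hkk, ← List.append_assoc, ← hrk, S.append, hYk', hx₂]
        simp [S.append, S.nil, mul_assoc])
      simp [hh] at this
    · refine ⟨x₂, k₂ ++ j', ?_, by simp [hk₂], hk', hh, ?_, hsk ▸ hsG⟩
      · rw [hxj, S.append, hYk', S.append, mul_assoc]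
      · rw [List.append_assoc, ← hkj]; exact hkh'

/-- If the two overlaps give different classes, both arise from one level deeper: `x` itself ends in
overlaps of `G a` with `G (!a)`, preceding a common remainder `m`. The two shapes are applied to the
class of `x ++ k`, then to the shorter class of `Y`. -/
theorem IsTame.adj_dichotomy (S : IsTame G φ) {a : Bool} {W : M} (hW : SFClass φ W)
    {x k h k₁ h₁ : List α} (hWx : W = φ x * φ k * φ h) (hadj : Adj G φ a x k h)
    (hadj₁ : Adj G φ a x k₁ h₁) :
    φ x * φ k = φ x * φ k₁ ∨ ∃ u t p u' t' p' m, t ≠ [] ∧ p ≠ [] ∧ t' ≠ [] ∧ p' ≠ [] ∧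
      t ++ p ∈ G a ∧ t' ++ p' ∈ G a ∧ p ++ m ++ k ∈ G (!a) ∧ p' ++ m ++ k₁ ∈ G (!a) ∧
      φ x = φ u * φ t * φ p * φ m ∧ φ x = φ u' * φ t' * φ p' * φ m ∧
      φ u * φ t * φ p = φ u' * φ t' * φ p' := by
  obtain ⟨u, j, hx, hj, hk, hh, hjk, hkh⟩ := hadj
  obtain ⟨u₁, q, hx₁, hq, hk₁, hh₁, hqk, hkh₁⟩ := hadj₁
  have hWx₁ : W = φ x * φ k₁ * φ h₁ := by
    rw [hWx, mul_assoc, mul_assoc, ← S.append k, ← S.append k₁, S.congr hkh hkh₁]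
  have hE : φ (u₁ ++ q ++ k) = φ u * φ (j ++ k) := by
    simp only [S.append]; rw [← hx₁, hx, mul_assoc]
  have hSE : SFClass φ (φ (u₁ ++ q ++ k)) := S.sf_mid (p := []) (s := h) hW (by
    rw [hWx, hx₁, S.nil]; simp [S.append, mul_assoc])
  rcases S.cases_of_no_end hSE (a := !a)
    (by
      simp only [Bool.not_not]
      exact S.no_end hW hh hkh [] (by rw [hWx, hx₁]; simp [S.append, S.nil, mul_assoc]))
    hjk hE _ rfl with ⟨x', V, hV, hx'⟩ | ⟨Y, h', x₂, k₂, hY, ⟨u₂, t, hx₂, ht, hk₂, hh', htk, hkh'⟩, hYk⟩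
  · left
    rcases List.append_eq_append_iff.1 hx' with ⟨e, he, hke⟩ | ⟨j', hxj, hVj⟩
    · have := S.not_prefix (g := j ++ e) (m := V) hW hV hjk (by simp [hke]) u h (by
        rw [hWx, hx, hke]; simp [S.append, mul_assoc])
      simp [hj] at this
    · have hqj : q = j' := by
        rcases List.append_eq_append_iff.1 hxj with ⟨e, he, hqe⟩ | ⟨e, he, hje⟩
        · have := S.not_prefix (g := e) (m := j' ++ k₁) hW hV hqk (by simp [hqe]) u₁ h (by
            rw [hWx, hx₁, hqe, hVj]; simp [S.append, mul_assoc])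
          simp [hqe, this]
        · have := S.not_prefix (g := e) (m := q ++ k) hW hqk hV (by simp [hje, hVj]) x' h₁ (by
            rw [hWx₁, hx₁, he]; simp [S.append, mul_assoc])
          simp [hje, this]
      rw [hx₁, mul_assoc, mul_assoc, ← S.append q k, ← S.append q k₁, S.congr hqk hV, hVj, hqj]
  · simp only [Bool.not_not] at htk
    rcases List.append_eq_append_iff.1 hY with ⟨e, he, hke⟩ | ⟨j₂, hqj, hhj⟩
    · have := S.not_suffix (g := h' ++ h) hW htk hkh (m := e) (by simp [hke]) u₂ [] (by
        rw [hWx, hx₁, hke, ← S.append u₁ q, S.append e, ← mul_assoc, ← S.append, ← he, hYk, hx₂]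
        simp [S.append, S.nil, mul_assoc])
      simp [hh'] at this
    have hbad₀ : ∀ e, u₁ = Y ++ e → j₂ = e ++ q → False := by
      intro e hue hje
      have := S.not_prefix (g := k₂ ++ e) (m := q ++ k) hW hqk hkh' (by simp [hhj, hje]) x₂ h₁ (by
        rw [hWx₁, hx₁, hue, S.append Y, hYk]; simp [S.append, mul_assoc])
      simp [hk₂] at this
    rcases List.append_eq_append_iff.1 hqj with ⟨p', hYp, hqp⟩ | ⟨e, hue, hje⟩
    swap
    · exact (hbad₀ e hue hje).elim
    have hp' : p' ≠ [] := by
      rintro rfl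
      exact hbad₀ [] (by simpa using hYp.symm) (by simpa using hqp.symm)
    have hFW : W = φ Y * φ j₂ * φ k * φ h := by
      rw [hWx, hx₁, hYp, hqp]; simp [S.append, mul_assoc]
    have hSF : SFClass φ (φ Y) := S.sf_mid (p := []) (s := j₂ ++ k ++ h) hW (by
      rw [hFW, S.nil]; simp [S.append, mul_assoc])
    rcases S.cases_of_no_end hSF (a := a) (z₀ := t ++ k₂) (x₀ := u₂)
      (S.no_end hW (h := h') hh' hkh' h (by rw [hFW, hhj]; simp [S.append, mul_assoc]))
      htk (by rw [hYk, hx₂]; simp [S.append, mul_assoc]) Y rfl with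
      ⟨x₃, T, hT, hx₃⟩ | ⟨Y₃, h₃, x₃, k₃, hY₃, ⟨u₃, v, hx₃, hv, hk₃, hh₃, hvk, hkh₃⟩, hYk₃⟩
    · have hbad : ∀ e, p' = e ++ T → False := by
        intro e he
        have h5 := S.replace (!a) e T (t ++ k₂) (j₂ ++ k₁)
          (by simpa [hqp, he] using hqk) (by simpa using hT) (by simpa using htk)
          (S.sf_mid (p := u₁) (s := h₁) hW (by
            rw [hWx₁, hx₁, hqp, he]; simp [S.append, mul_assoc]))
        have := S.not_prefix (g := e ++ t) (m := k₂ ++ (j₂ ++ k₁)) hW hkh' h5 (by simp) u₁ h (by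
          rw [hFW, hYp, he, hhj]; simp only [S.append, S.congr hT htk, mul_assoc])
        simp [ht] at this
      rw [hYp] at hx₃
      rcases List.append_eq_append_iff.1 hx₃ with ⟨e, he, hpe⟩ | ⟨t', hut, hTt⟩
      · exact (hbad e hpe).elim
      have ht' : t' ≠ [] := by
        rintro rfl
        exact hbad [] (by simpa using hTt.symm)
      refine Or.inr ⟨u₂, t, k₂, x₃, t', p', j₂, ht, hk₂, ht', hp', htk, hTt ▸ hT,
        by simpa [hhj] using hkh', by simpa [hqp] using hqk, ?_, ?_, ?_⟩
      · rw [hx₁, ← S.append, hqj, S.append, hYk, hx₂]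
      · rw [hx₁, hut, hqp]; simp [S.append, mul_assoc]
      · rw [← hx₂, ← hYk, hYp, hut]; simp [S.append, mul_assoc]
    · rw [hYp] at hY₃
      rcases List.append_eq_append_iff.1 hY₃ with ⟨e, he, hpe⟩ | ⟨e, hue, hhe⟩
      · have := S.not_suffix (g := h₃ ++ j₂ ++ k₁) hW hvk hqk (m := e)
          (by simp [hqp, hpe]) u₃ h₁ (by
          rw [hWx₁, hx₁, hqp, hpe]
          simp only [S.append, mul_assoc]
          rw [← mul_assoc (φ u₁), ← S.append u₁, ← he, hYk₃, hx₃]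
          simp only [mul_assoc])
        simp [hh₃] at this
      · refine Or.inr ⟨u₂, t, k₂, x₃, k₃ ++ e, p', j₂, ht, hk₂, by simp [hk₃], hp', htk,
          by simpa [hhe] using hkh₃,
          by simpa [hhj] using hkh', by simpa [hqp] using hqk, ?_, ?_, ?_⟩
        · rw [hx₁, ← S.append, hqj, S.append, hYk, hx₂]
        · rw [hx₁, hue, hqp]; simp only [S.append, hYk₃, mul_assoc]
        · rw [← hx₂, ← hYk, hYp, hue]; simp only [S.append, hYk₃, mul_assoc]

end Rewriting

/-! ### Uniqueness of overlaps and finiteness of square-free classes. -/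

section Rewriting

variable {α M : Type*} [Monoid M] {G : Bool → Set (List α)} {φ : List α → M}

theorem Adj.congr {a : Bool} {x y k h : List α} (hadj : Adj G φ a x k h) (e : φ x = φ y) :
    Adj G φ a y k h := by
  obtain ⟨u, j, hx, hr⟩ := hadj
  exact ⟨u, j, e ▸ hx, hr⟩

theorem IsPresentation.end_unique (S : IsPresentation G φ) {a : Bool} {W : M}
    (hW : SFClass φ W) {x z x' z' : List α} (hz : z ∈ G a) (hz' : z' ∈ G a)
    (h : x ++ z = x' ++ z') (hWx : W = φ x * φ z) : x = x' := by
  rcases List.append_eq_append_iff.1 h with ⟨e, he, hse⟩ | ⟨e, he, hse⟩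
  · have : e = [] := S.not_prefix hW hz' hz hse x [] (by
      rw [hWx, hse]; simp [S.append, S.nil, mul_assoc])
    simp [he, this]
  · have : e = [] := S.not_prefix hW hz hz' hse x' [] (by
      rw [hWx, he]; simp [S.append, S.nil, mul_assoc])
    simp [he, this]

/-- In the second case of the dichotomy there are three overlaps of `G b` with `G (!b)`, with common
parts `p`, `p'` and `c`. By pigeonhole two coincide: `p = p'` gives the claim, and `c` equal to
either one gives a square. -/
theorem IsTame.adj_unique (S : IsTame G φ) {b : Bool} {W : M} (hW : SFClass φ W)
    {x d c e k h k₁ h₁ : List α} (hdc : d ++ c ∈ G b) (hce : c ++ e ∈ G (!b)) (he : e ≠ [])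
    (hWx : W = φ x * φ d * φ c * φ e) (hadj : Adj G φ b x k h) (hadj₁ : Adj G φ b x k₁ h₁) :
    φ x * φ k = φ x * φ k₁ := by
  obtain ⟨-, -, -, -, hk, hh, -, hkh⟩ := id hadj
  obtain ⟨-, -, -, -, hk₁, hh₁, -, hkh₁⟩ := id hadj₁
  have hWk : W = φ x * φ k * φ h * φ e := by
    rw [hWx, mul_assoc (φ x), ← S.append d, S.congr hdc hkh, S.append]
    simp only [mul_assoc]
  have hWk₁ : W = φ x * φ k₁ * φ h₁ * φ e := by
    rw [hWx, mul_assoc (φ x), ← S.append d, S.congr hdc hkh₁, S.append]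
    simp only [mul_assoc]
  have hE : SFClass φ (φ x * φ k * φ h) :=
    S.sf_mid (p := []) (s := e) hW (by rw [hWk, S.nil, one_mul])
  rcases S.adj_dichotomy hE rfl hadj hadj₁ with
    h | ⟨u, t, p, u', t', p', m, -, -, -, -, htp, htp', hpk, hpk', hx, hx', -⟩
  · exact h
  have hdc0 : d ++ c ++ m ≠ [] := by
    intro h0
    exact S.ne_nil _ _ hdc (List.append_eq_nil_iff.1 h0).1
  -- Rewriting `s ++ c` to `d ++ c` and `c ++ e` to `c ++ m ++ q` exhibits the square of `d ++ c ++
  -- m`.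
  have square : ∀ v s q y, s ++ c ∈ G b → c ++ m ++ q ∈ G (!b) → y = v ++ s ++ c ++ m →
      φ x = φ y → False := by
    intro v s q y hs hq hy hxy
    refine hdc0 (hW (v ++ (d ++ c) ++ m ++ d ++ (c ++ m ++ q)) ?_ v (d ++ c ++ m) q (by simp))
    rw [hWx, hxy, hy, S.append _ (c ++ m ++ q), S.congr hq hce, S.append, S.append, S.append,
      S.congr hdc hs]
    simp [S.append, mul_assoc]
  rcases S.overlap b t p (m ++ k) t' p' (m ++ k₁) d c e htp (by simpa using hpk) (by simp [hk])
      (S.sf_mid (p := u) (s := h ++ e) hW (by rw [hWk, hx]; simp [S.append, mul_assoc]))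
      htp' (by simpa using hpk') (by simp [hk₁])
      (S.sf_mid (p := u') (s := h₁ ++ e) hW (by rw [hWk₁, hx']; simp [S.append, mul_assoc]))
      hdc hce he
      (S.sf_mid (p := x) (s := []) hW (by rw [hWx]; simp [S.nil, mul_assoc])) with rfl | rfl | rfl
  · rw [hx]
    have := S.congr hpk hpk'
    simp only [S.append, mul_assoc] at this ⊢
    rw [this]
  · exact (square u t k _ htp hpk rfl (by simp [S.append, hx, mul_assoc])).elim
  · exact (square u' t' k₁ _ htp' hpk' rfl (by simp [S.append, hx', mul_assoc])).elim

theorem IsTame.block_cases (S : IsTame G φ) {b : Bool} {E : M} {d c e : List α}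
    (hW : SFClass φ (E * φ e)) (hdc : d ++ c ∈ G b) (hce : c ++ e ∈ G (!b)) (he : e ≠ [])
    {x k h : List α} (hadj : Adj G φ b x k h) (hEx : E = φ x * φ k * φ h) :
    ∀ Y, φ Y = E →
      (∃ y z, z ∈ G b ∧ Y = y ++ z ∧ ∃ k' h', Adj G φ b y k' h' ∧ φ y * φ k' = φ x * φ k) ∨
      (∃ Y' h' y k', Y = Y' ++ h' ∧ Adj G φ b y k' h' ∧ φ Y' = φ y * φ k' ∧
        φ Y' = φ x * φ k) := by
  have hE : SFClass φ E := S.sf_mid (p := []) (s := e) hW (by rw [S.nil, one_mul])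
  obtain ⟨-, -, -, -, -, -, -, hkh⟩ := id hadj
  refine S.reach_cases hE (P := fun y => ∃ k' h', Adj G φ b y k' h' ∧ φ y * φ k' = φ x * φ k)
    (Q := fun Y => φ Y = φ x * φ k) ?_ ?_ ?_ ?_ ?_ hkh
    (by rw [hEx, S.append, mul_assoc]) ⟨k, h, hadj, rfl⟩
  · rintro y y' hy ⟨k', h', h1, h2⟩
    exact ⟨k', h', h1.congr hy, hy ▸ h2⟩
  · intro y y' hy h
    exact hy ▸ h
  · intro r m z _ _ _ hEr hm
    refine S.no_end hW he hce [] (m := E) (by rw [S.nil, mul_one]) r _ hm ?_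
    rw [hEr]; simp [S.append, mul_assoc]
  · rintro y k₁ h₁ ⟨k', h', h1, h2⟩ hEy hadj₁
    obtain ⟨-, -, -, -, -, -, -, hkh₁⟩ := id hadj₁
    rw [S.append, ← h2]
    refine S.adj_unique hW hdc hce he ?_ hadj₁ h1
    rw [mul_assoc (φ y), ← S.append d, S.congr hdc hkh₁, hEy, S.append, mul_assoc (φ y)]
  · intro Y h' y k' r s hY hadj' hYy hEY hYs hs
    obtain ⟨k₂, hk₂, -, hadj₂⟩ := S.adj_of_ends hE hadj' hYy hEY hYs hs
    exact ⟨k₂, h', hadj₂, by rw [← S.append, ← hk₂, hY]⟩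

/-- By `block_cases` the class of `x ++ k` is an invariant of the whole class `E`; evaluating it on
the word `x' ++ k' ++ h'` identifies it. -/
theorem IsTame.block_unique (S : IsTame G φ) {b : Bool} {E : M} {d c e : List α}
    (hW : SFClass φ (E * φ e)) (hdc : d ++ c ∈ G b) (hce : c ++ e ∈ G (!b)) (he : e ≠ [])
    {x k h x' k' h' : List α} (hadj : Adj G φ b x k h) (hEx : E = φ x * φ k * φ h)
    (hadj' : Adj G φ b x' k' h') (hEx' : E = φ x' * φ k' * φ h') :
    φ x' * φ k' = φ x * φ k := by
  have hE : SFClass φ E := S.sf_mid (p := []) (s := e) hW (by rw [S.nil, one_mul])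
  obtain ⟨-, -, -, -, -, -, -, hkh⟩ := id hadj'
  have huniq : ∀ k₁ h₁, Adj G φ b x' k₁ h₁ → φ x' * φ k' = φ x' * φ k₁ := by
    intro k₁ h₁ hadj₁
    refine S.adj_unique hW hdc hce he ?_ hadj' hadj₁
    rw [mul_assoc (φ x'), ← S.append d, S.congr hdc hkh, hEx', S.append, mul_assoc (φ x')]
  rcases S.block_cases hW hdc hce he hadj hEx (x' ++ (k' ++ h'))
    (by rw [hEx', S.append, S.append, mul_assoc]) with
    ⟨y, z, hz, hy, k₁, h₁, h1, h2⟩ | ⟨Y, h₁, y, k₁, hY, h1, h2, h3⟩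
  · have := S.end_unique hE hkh hz hy (by rw [hEx', S.append, mul_assoc])
    subst this
    rw [← h2]
    exact huniq _ _ h1
  · obtain ⟨k₂, hk₂, -, h4⟩ := S.adj_of_ends hE h1 h2 (by
      rw [hEx', ← S.append Y, ← hY, mul_assoc, ← S.append, ← S.append]) hY.symm hkh
    rw [← h3, hk₂, S.append]
    exact huniq _ _ h4

/-- Prefixes of words of `T` followed by a word of `G a` or a suffix of such a word. -/
def blowup (G : Bool → Set (List α)) (φ : List α → M) (a : Bool) (T : Set (List α)) :
    Set (List α) :=
  {Y | ∃ x y z k h, Y = x ++ z ∧ x ++ y ∈ T ∧ k ++ z = h ∧ h ∈ G a ∧ SFClass φ (φ h)}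

theorem IsTame.blowup_finite (S : IsTame G φ) (a : Bool) {T : Set (List α)} (hT : T.Finite) :
    (blowup G φ a T).Finite := by
  have h1 : (⋃ t ∈ T, {x | x ∈ t.inits}).Finite :=
    hT.biUnion fun t _ => List.finite_toSet t.inits
  have h2 : (⋃ t ∈ {z | z ∈ G a ∧ SFClass φ (φ z)}, {x | x ∈ t.tails}).Finite :=
    (S.finite a).biUnion fun t _ => List.finite_toSet t.tails
  refine (Set.Finite.image2 (fun x z => x ++ z) h1 h2).subset ?_
  rintro Y ⟨x, y, z, k, h, rfl, hxy, rfl, hh, hs⟩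
  refine ⟨x, ?_, z, ?_, rfl⟩
  · simp only [Set.mem_iUnion]
    exact ⟨_, hxy, by simp⟩
  · simp only [Set.mem_iUnion]
    exact ⟨_, ⟨hh, hs⟩, by simp⟩

theorem IsPresentation.finite_left (S : IsPresentation G φ) {m : M} {q : List α}
    (h : {y | φ y = m * φ q}.Finite) : {y | φ y = m}.Finite := by
  refine Set.Finite.of_finite_image (f := fun y => y ++ q) (h.subset ?_)
    (fun _ _ _ _ h => List.append_cancel_right h)
  rintro _ ⟨y, rfl, rfl⟩
  exact S.append _ _

/-- Every prefix that can precede the block or its tail is in the class of `x₀` or is a prefix of a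
word in a good class, so all words lie in one finite `blowup`. -/
theorem IsTame.finite_of_good (S : IsTame G φ) {a : Bool} {x₀ z₀ : List α} (hz₀ : z₀ ∈ G a)
    {W : M} (hW : SFClass φ W) (hx₀ : W = φ x₀ * φ z₀)
    (hfin : {y | φ y = φ x₀}.Finite)
    (habs : ∀ r m z, φ (r ++ m) = φ x₀ → m ≠ [] → z ∈ G a → m ++ z ∈ G (!a) → False)
    (Good : M → Prop) {K : Set (List α)} (hK : K.Finite) (hGK : ∀ Y, Good (φ Y) → Y ∈ K)
    (h2 : ∀ x k h, (φ x = φ x₀ ∨ ∃ k' h', Adj G φ a x k' h' ∧ Good (φ x * φ k')) →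
      W = φ x * φ k * φ h → Adj G φ a x k h → Good (φ x * φ k)) :
    {Y | φ Y = W}.Finite := by
  refine (S.blowup_finite a (hfin.union hK)).subset ?_
  intro Y hY
  have hsub : ∀ {p q : List α}, p ++ q = Y → SFClass φ (φ q) := by
    rintro p q rfl
    refine S.sf_mid (p := p) (s := []) hW ?_
    rw [← hY, S.append, S.nil, mul_one]
  have key := S.reach_cases hW
    (P := fun x => φ x = φ x₀ ∨ ∃ k' h', Adj G φ a x k' h' ∧ Good (φ x * φ k'))
    (Q := fun Y => Good (φ Y)) ?_ (fun _ _ h => h ▸ id) ?_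
    (fun x k h hP hWx hadj => by rw [S.append]; exact h2 x k h hP hWx hadj)
    ?_ hz₀ hx₀ (Or.inl rfl) Y hY
  · rcases key with ⟨x, z, hz, hYx, hP⟩ | ⟨Y', h, x, k, hYY, hadj, hYx, hQ⟩
    · rcases hP with hP | ⟨k, h, hadj, hg⟩
      · exact ⟨x, [], z, [], z, hYx, Or.inl (by simpa using hP), rfl, hz, hsub hYx.symm⟩
      · exact ⟨x, k, z, [], z, hYx, Or.inr (hGK _ (by rwa [S.append])), rfl, hz, hsub hYx.symm⟩
    · obtain ⟨-, -, -, -, -, -, -, hkh⟩ := id hadj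
      refine ⟨Y', [], h, k, k ++ h, hYY, Or.inr (hGK _ (by simpa using hQ)), rfl, hkh, ?_⟩
      refine S.sf_mid (p := x) (s := []) hW ?_
      rw [← hY, hYY, S.append, hYx, S.append, S.nil, mul_one, mul_assoc]
  · rintro x y hxy (h | ⟨k, h, h1, h2⟩)
    · exact Or.inl (hxy ▸ h)
    · exact Or.inr ⟨k, h, h1.congr hxy, hxy ▸ h2⟩
  · rintro r m z (hP | ⟨k, h, ⟨u, j, hx, hj, hk, hh, hjk, hkh⟩, -⟩) hm hz hWr hmz
    · exact habs r m z hP hm hz hmz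
    · have h3 := S.replace (!a) m z (k ++ h) [] (by simpa using hmz) (by simpa using hz)
        (by simpa using hkh) (S.sf_mid (p := r) (s := []) hW (by
          rw [hWr]; simp [S.append, S.nil, mul_assoc]))
      refine hh (S.not_suffix (m := m ++ k) hW hjk h3 (by simp) u [] ?_)
      rw [hWr, S.congr hz hkh, hx]; simp [S.append, S.nil, mul_assoc]
  · intro Y h x k r s hQ hadj hYx hWY hYs hs
    obtain ⟨k', hk', -, hadj'⟩ := S.adj_of_ends hW hadj hYx hWY hYs hs
    exact Or.inr ⟨k', h, hadj', by rwa [← S.append, ← hk']⟩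

/-- Induction on a bound for the lengths in the class of `x₀`: if `x₀` equals `u ++ q` with `q`
nonempty, the class of `u` has a smaller bound. -/
theorem IsTame.finite_append (S : IsTame G φ) (n : ℕ) :
    ∀ x₀, {y | φ y = φ x₀}.Finite → (∀ y, φ y = φ x₀ → y.length ≤ n) → ∀ a z₀, z₀ ∈ G a →
      SFClass φ (φ x₀ * φ z₀) → {Y | φ Y = φ x₀ * φ z₀}.Finite := by
  induction n using Nat.strong_induction_on with
  | _ n ih =>
  intro x₀ hfin hlen a z₀ hz₀ hW
  have ih' : ∀ u q a z, q ≠ [] → φ u * φ q = φ x₀ → z ∈ G a → SFClass φ (φ u * φ z) →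
      {Y | φ Y = φ u * φ z}.Finite := by
    intro u q a z hq huq hz hs
    have hlt : ∀ y, φ y = φ u → y.length + q.length ≤ n := by
      intro y hy
      have := hlen (y ++ q) (by rw [S.append, hy, huq])
      simpa using this
    have hq' := List.length_pos_iff.2 hq
    refine ih (n - q.length) (by have := hlt u rfl; omega) u (S.finite_left (q := q) ?_) ?_ a z hz hs
    · rwa [huq]
    · intro y hy
      have := hlt y hy
      omega
  -- If a block can be absorbed into a word of `G (!a)`, that longer word is appended to the shorter
  -- `r`, and induction applies.
  by_cases habs : ∃ r m z, φ (r ++ m) = φ x₀ ∧ m ≠ [] ∧ z ∈ G a ∧ m ++ z ∈ G (!a)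
  · obtain ⟨r, m, z, hr, hm, hz, hmz⟩ := habs
    have he : φ x₀ * φ z₀ = φ r * φ (m ++ z) := by
      rw [S.congr hz₀ hz, ← hr]; simp [S.append, mul_assoc]
    rw [he] at hW ⊢
    exact ih' r m (!a) (m ++ z) hm (by rw [← hr, S.append]) hmz hW
  have habs' : ∀ r m z, φ (r ++ m) = φ x₀ → m ≠ [] → z ∈ G a → m ++ z ∈ G (!a) → False :=
    fun r m z h1 h2 h3 h4 => habs ⟨r, m, z, h1, h2, h3, h4⟩
  by_cases hadj₀ : ∃ k h, Adj G φ a x₀ k h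
  swap
  · refine S.finite_of_good hz₀ hW rfl hfin habs' (fun _ => False) Set.finite_empty
      (fun _ h => h.elim) ?_
    rintro x k h (hx | ⟨_, _, -, h⟩) - hadj
    · exact hadj₀ ⟨k, h, hadj.congr hx⟩
    · exact h
  obtain ⟨k₀, h₀, hadj₀⟩ := hadj₀
  -- `x₀ ++ k₀` equals `u` followed by a word of `G (!a)`, and `u` is shorter than `x₀`.
  have hE₀ : {Y | φ Y = φ x₀ * φ k₀}.Finite := by
    obtain ⟨u, j, hx, hj, hk, hh, hjk, hkh⟩ := hadj₀
    have he : φ x₀ * φ k₀ = φ u * φ (j ++ k₀) := by rw [hx, S.append, mul_assoc]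
    rw [he]
    refine ih' u j (!a) _ hj hx.symm hjk (S.sf_mid (p := []) (s := h₀) hW ?_)
    rw [← he, S.congr hz₀ hkh, S.append, S.nil, one_mul, mul_assoc]
  -- A class is good if it is that of `x₀ ++ k₀`, or ends in an overlap `x, k, h` where `x ++ k` can
  -- be completed to that class. The clause with `d`, `c`, `e` is what uniqueness of blocks
  -- requires.
  refine S.finite_of_good hz₀ hW rfl hfin habs'
    (fun m => (∃ d c e, d ++ c ∈ G (!a) ∧ c ++ e ∈ G a ∧ e ≠ [] ∧ φ x₀ * φ z₀ = m * φ e) ∧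
      (m = φ x₀ * φ k₀ ∨ ∃ x k h q, m = φ x * φ k * φ h ∧ Adj G φ (!a) x k h ∧
        φ x * φ k * φ q = φ x₀ * φ k₀))
    (hE₀.union (S.blowup_finite (!a) hE₀)) ?_ ?_
  · rintro Y ⟨⟨d, c, e, hdc, hce, he, hWe⟩, hY | ⟨x, k, h, q, hY, hadj, hq⟩⟩
    · exact Or.inl hY
    · right
      rw [hWe] at hW
      have hsub : ∀ {p q : List α}, p ++ q = Y → SFClass φ (φ q) := by
        rintro p q rfl
        refine S.sf_mid (p := p) (s := e) hW ?_
        rw [S.append]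
      rcases S.block_cases hW hdc (by simpa using hce) he hadj hY Y rfl with
        ⟨y, z, hz, hYz, k', h', h1, h2⟩ | ⟨Y', h', y, k', hYY, hadj', hYy, hYx⟩
      · refine ⟨y, k' ++ q, z, [], z, hYz, ?_, rfl, hz, hsub hYz.symm⟩
        change φ _ = _
        rw [← hq, ← h2]; simp [S.append, mul_assoc]
      · obtain ⟨-, -, -, -, -, -, -, hkh⟩ := id hadj'
        refine ⟨Y', q, h', k', k' ++ h', hYY, ?_, rfl, hkh, ?_⟩
        · change φ _ = _
          rw [S.append, hYx, hq]
        · refine S.sf_mid (p := y) (s := e) hW ?_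
          rw [hYY, S.append, hYy, S.append, mul_assoc (φ y)]
  · intro x k h hP hWx hadj
    have htype : ∀ k h, Adj G φ a x k h → φ x₀ * φ z₀ = φ x * φ k * φ h →
        (∃ d c e, d ++ c ∈ G (!a) ∧ c ++ e ∈ G a ∧ e ≠ [] ∧
          φ x₀ * φ z₀ = φ x * φ k * φ e) := by
      rintro k h ⟨u, j, hx, hj, hk, hh, hjk, hkh⟩ hWx
      exact ⟨j, k, h, hjk, hkh, hh, hWx⟩
    refine ⟨htype k h hadj hWx, ?_⟩
    have hP' : ∃ k' h', Adj G φ a x k' h' ∧ (φ x * φ k' = φ x₀ * φ k₀ ∨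
        ∃ y k h q, φ x * φ k' = φ y * φ k * φ h ∧ Adj G φ (!a) y k h ∧
        φ y * φ k * φ q = φ x₀ * φ k₀) := by
      rcases hP with hP | ⟨k', h', h1, -, h2⟩
      · exact ⟨k₀, h₀, hadj₀.congr hP.symm, Or.inl (by rw [hP])⟩
      · exact ⟨k', h', h1, h2⟩
    obtain ⟨k', h', hadj', hg⟩ := hP'
    have hWx' : φ x₀ * φ z₀ = φ x * φ k' * φ h' := by
      obtain ⟨-, -, -, -, -, -, -, hkh⟩ := id hadj
      obtain ⟨-, -, -, -, -, -, -, hkh'⟩ := id hadj'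
      rw [hWx, mul_assoc, mul_assoc, ← S.append k, ← S.append k', S.congr hkh hkh']
    rcases S.adj_dichotomy hW hWx' hadj' hadj with
      h | ⟨u, t, p, u', t', p', m, ht, hp, ht', hp', htp, htp', hpk, hpk', hx, hx', he⟩
    · rwa [← h]
    right
    refine ⟨u' ++ t', p', m ++ k, ?_⟩
    have hq : ∃ q, φ (u ++ t) * φ p * φ q = φ x₀ * φ k₀ := by
      rcases hg with hg | ⟨y, k₂, h₂, q, hy, hadj₂, hq⟩
      · exact ⟨m ++ k', by rw [← hg, hx]; simp [S.append, mul_assoc]⟩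
      · refine ⟨q, ?_⟩
        obtain ⟨d, c, e, hdc, hce, hne, hWe⟩ := htype k' h' hadj' hWx'
        rw [← hq]
        congr 1
        -- The overlap from the dichotomy and the one recorded in goodness lie in the same class, so
        -- their classes before the tail agree and the completion `q` carries over.
        refine S.block_unique (h' := m ++ k') (hWe ▸ hW) hdc (by simpa using hce) hne hadj₂ hy
          ⟨u, t, S.append _ _, ht, hp, ?_, by simpa using htp, by simpa using hpk⟩ ?_
        · obtain ⟨-, -, -, -, hk', -⟩ := hadj'
          simp [hk']
        · rw [hx]; simp [S.append, mul_assoc]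
    obtain ⟨q, hq⟩ := hq
    refine ⟨q, ?_, ⟨u', t', S.append _ _, ht', hp', ?_, by simpa using htp', by simpa using hpk'⟩,
      ?_⟩
    · rw [hx']; simp [S.append, mul_assoc]
    · obtain ⟨-, -, -, -, hk, -⟩ := hadj
      simp [hk]
    · rw [← hq, S.append, S.append, he]

/-- Appending a letter `c` either merely appends it to every word of the old class, or some rewrite
reaches it; then the class ends in a block preceded by a prefix of a word of the old class, and
`finite_append` applies. -/
theorem IsTame.finite_class (S : IsTame G φ) (w : List α) (hw : SFClass φ (φ w)) :
    {y | φ y = φ w}.Finite := by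
  induction w using List.reverseRecOn with
  | nil =>
    refine (Set.finite_singleton []).subset ?_
    intro y hy
    simp only [Set.mem_ofPred_eq, S.nil] at hy
    have hs : NoSquare (y ++ y) := hw _ (by simp [S.append, S.nil, hy])
    exact hs [] y [] (by simp)
  | append_singleton w c ih =>
    have hfin := ih (S.sf_mid (p := []) (s := [c]) hw (by simp [S.nil, S.append]))
    by_cases h : ∃ y z a, z ∈ G a ∧ φ (y ++ z) = φ (w ++ [c]) ∧ ∃ w', φ w' = φ w ∧ w' ++ [c] = y ++ z
    · obtain ⟨y, z, a, hz, he, w', hw', hyz⟩ := h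
      rw [S.append] at he
      rw [← he] at hw ⊢
      obtain ⟨z', rfl⟩ : ∃ z', w' = y ++ z' := by
        rcases List.append_eq_append_iff.1 hyz with ⟨e, he, hce⟩ | ⟨e, he, -⟩
        · rcases List.singleton_eq_append_iff.1 hce with ⟨rfl, -⟩ | ⟨-, rfl⟩
          · exact ⟨[], by simp [he]⟩
          · exact (S.ne_nil _ _ hz rfl).elim
        · exact ⟨e, he⟩
      have hy : {x | φ x = φ y}.Finite := by
        refine S.finite_left (q := z') ?_
        rwa [← S.append, hw']
      obtain ⟨n, hn⟩ := (hy.image List.length).bddAbove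
      exact S.finite_append n y hy (fun x hx => hn ⟨x, hx, rfl⟩) a z hz hw
    · refine (hfin.image (fun x => x ++ [c])).subset ?_
      intro y hy
      have key : ReflTransGen (RStep G) (w ++ [c]) y := (S.eq_iff _ _).1 hy.symm
      clear hy
      induction key with
      | refl => exact ⟨w, rfl, rfl⟩
      | tail hst hs ih =>
        obtain ⟨x, hx, rfl⟩ := ih
        obtain ⟨a, r, t, s, s', hs, hs', hxs, rfl⟩ := hs
        rcases List.eq_nil_or_concat t with rfl | ⟨t, c', rfl⟩
        · refine (h ⟨r, s, a, hs, ?_, x, hx, by simpa using hxs⟩).elim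
          simp only [List.append_nil] at hxs
          rw [← hxs, S.append, hx, S.append]
        · rw [List.concat_eq_append, ← List.append_assoc] at hxs
          obtain ⟨rfl, hc⟩ := List.append_inj' hxs rfl
          refine ⟨r ++ s' ++ t, ?_, by simp [hc]⟩
          rw [Set.mem_ofPred_eq] at hx ⊢
          rw [← hx]; simp [S.append, S.congr hs hs']

end Rewriting

/-! ### Tameness for two relations. -/

section TwoRelations

variable {α M : Type*} [Monoid M] {φ : List α → M}

theorem RStep.symm {G : Bool → Set (List α)} {x y : List α} (h : RStep G x y) : RStep G y x := by
  obtain ⟨a, r, s, z, z', hz, hz', hx, hy⟩ := h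
  exact ⟨a, r, s, z', z, hz', hz, hy, hx⟩

theorem RStep.append {G : Bool → Set (List α)} {x y : List α} (p q : List α) (h : RStep G x y) :
    RStep G (p ++ x ++ q) (p ++ y ++ q) := by
  obtain ⟨a, r, s, z, z', hz, hz', rfl, rfl⟩ := h
  exact ⟨a, p ++ r, s ++ q, z, z', hz, hz', by simp, by simp⟩

theorem reflTransGen_rstep_symm {G : Bool → Set (List α)} {x y : List α}
    (h : ReflTransGen (RStep G) x y) : ReflTransGen (RStep G) y x := by
  induction h with
  | refl => exact .refl
  | tail _ hs ih => exact .head hs.symm ih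

theorem reflTransGen_rstep_append {G : Bool → Set (List α)} {x y : List α} (p q : List α)
    (h : ReflTransGen (RStep G) x y) :
    ReflTransGen (RStep G) (p ++ x ++ q) (p ++ y ++ q) :=
  h.lift (fun x => p ++ x ++ q) fun _ _ => RStep.append p q

/-- The congruence on words generated by `G`. -/
def wordCon (G : Bool → Set (List α)) : Con (FreeMonoid α) where
  r x y := ReflTransGen (RStep G) (FreeMonoid.toList x) (FreeMonoid.toList y)
  iseqv := ⟨fun _ => .refl, fun h => reflTransGen_rstep_symm h,
    fun h h' => h.trans h'⟩
  mul' {w x y z} h h' := by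
    have h1 := reflTransGen_rstep_append [] (FreeMonoid.toList y) h
    have h2 := reflTransGen_rstep_append (FreeMonoid.toList x) [] h'
    simp only [List.nil_append, List.append_nil] at h1 h2
    simpa only [FreeMonoid.toList_mul] using h1.trans h2

/-- The class of a word under the congruence generated by `G`. -/
def wordClass (G : Bool → Set (List α)) (x : List α) : (wordCon G).Quotient :=
  ((FreeMonoid.ofList x : FreeMonoid α) : (wordCon G).Quotient)

theorem isPresentation_wordClass (G : Bool → Set (List α)) :
    IsPresentation G (wordClass G) where
  nil := rfl
  append _ _ := rfl
  eq_iff _ _ := (wordCon G).eq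

theorem IsPresentation.of_generators {G G' : Bool → Set (List α)} (S : IsPresentation G φ)
    (h : ∀ a, ∃ b, G a ⊆ G' b) (h' : ∀ a z z', z ∈ G' a → z' ∈ G' a → φ z = φ z') :
    IsPresentation G' φ where
  nil := S.nil
  append := S.append
  eq_iff x y := by
    constructor
    · intro e
      refine ReflTransGen.mono ?_ _ _ ((S.eq_iff x y).1 e)
      rintro _ _ ⟨a, r, s, z, z', hz, hz', hx, hy⟩
      obtain ⟨b, hb⟩ := h a
      exact ⟨b, r, s, z, z', hb hz, hb hz', hx, hy⟩
    · intro e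
      induction e with
      | refl => rfl
      | tail _ hs ih =>
        obtain ⟨a, r, s, z, z', hz, hz', rfl, rfl⟩ := hs
        rw [ih]
        simp only [S.append, h' a z z' hz hz']

/-- The two sides of one defining relation. -/
def oneRel (u v : List α) (a : Bool) : Set (List α) :=
  if a then {u, v} else ∅

/-- The sides of two defining relations. -/
def twoRel (u₁ v₁ u₂ v₂ : List α) (a : Bool) : Set (List α) :=
  if a then {u₁, v₁} else {u₂, v₂}

/-- With the second family empty, the conditions on interaction are vacuous. This case serves to
prove that saturated families are finite. -/
theorem IsPresentation.isTame_oneRel {u v : List α} (S : IsPresentation (oneRel u v) φ)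
    (hu : u ≠ []) (hv : v ≠ []) : IsTame (oneRel u v) φ where
  toIsPresentation := S
  ne_nil a z hz := by
    cases a
    · simp [oneRel] at hz
    · rcases (by simpa [oneRel] using hz : z = u ∨ z = v) with rfl | rfl <;> assumption
  replace a s z z' t h hz _ _ := by
    cases a
    · simp [oneRel] at h
    · simp [oneRel] at hz
  overlap b d₁ c₁ e₁ _ _ _ _ _ _ h1 h2 := by
    cases b
    · simp [oneRel] at h1
    · simp [oneRel] at h2
  finite a := by
    refine Set.Finite.subset (s := {u, v}) (by simp) ?_
    rintro z ⟨hz, -⟩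
    cases a
    · simp [oneRel] at hz
    · simpa [oneRel] using hz

theorem IsPresentation.overlap_unique {G : Bool → Set (List α)} (S : IsPresentation G φ)
    {a : Bool} {d₁ c₁ e₁ d₂ c₂ e₂ : List α} (h : d₁ ++ c₁ = d₂ ++ c₂)
    (h₁ : c₁ ++ e₁ ∈ G a) (hs₁ : SFClass φ (φ d₁ * φ c₁ * φ e₁))
    (h₂ : c₂ ++ e₂ ∈ G a) (hs₂ : SFClass φ (φ d₂ * φ c₂ * φ e₂)) : c₁ = c₂ := by
  rcases List.append_eq_append_iff.1 h with ⟨e, he, hc⟩ | ⟨e, he, hc⟩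
  · have := S.not_prefix (g := e) (m := c₂ ++ e₁) hs₂ h₂ h₁ (by simp [hc]) d₁ []
      (by rw [he]; simp [S.append, S.nil, mul_assoc])
    simp [hc, this]
  · have := S.not_prefix (g := e) (m := c₁ ++ e₂) hs₁ h₁ h₂ (by simp [hc]) d₂ []
      (by rw [he]; simp [S.append, S.nil, mul_assoc])
    simp [hc, this]

/-- The words obtained from `w` by applying the relation `u = v`. -/
def family (u v w : List α) : Set (List α) :=
  {g | ReflTransGen (RStep (oneRel u v)) w g}

/-- A rewrite reaching into `c` would put a side of the relation in front of a nonempty suffix of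
the side `c ++ e`, creating a square. So all rewriting takes place in `d`. -/
theorem family_append {G : Bool → Set (List α)} (S : IsPresentation G φ) {a : Bool}
    {u v d c e : List α} (hG : G a = {u, v}) (hce : c ++ e ∈ G a) (he : e ≠ [])
    (hs : SFClass φ (φ d * φ c * φ e)) {g : List α} (hg : g ∈ family u v (d ++ c)) :
    ∃ d', g = d' ++ c ∧ φ d' = φ d := by
  induction (hg : ReflTransGen _ _ _) with
  | refl => exact ⟨d, rfl, rfl⟩
  | tail _ hst ih =>
    obtain ⟨d₁, rfl, hd₁⟩ := ih
    obtain ⟨b, r, t, s, s', hs₁, hs₂, hd, rfl⟩ := hst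
    cases b
    · simp [oneRel] at hs₁
    simp only [oneRel, if_true] at hs₁ hs₂
    rw [← hG] at hs₁ hs₂
    rcases List.append_eq_append_iff.1 hd with ⟨m, hm, hc⟩ | ⟨m, hm, hc⟩
    · have := S.not_suffix (g := t ++ e) (m := m) hs hs₁ hce (by simp [hc]) r [] (by
        rw [← hd₁, hc, S.append, ← mul_assoc (φ d₁), ← S.append d₁, ← hm]
        simp [S.append, S.nil, mul_assoc])
      simp [he] at this
    · refine ⟨r ++ s' ++ m, by simp [hc], ?_⟩
      rw [← hd₁, hm]
      simp [S.append, S.congr hs₁ hs₂]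

theorem family_subset {G : Bool → Set (List α)} (S : IsPresentation G φ) {a : Bool}
    {u v w g : List α} (hG : G a = {u, v}) (hg : g ∈ family u v w) : φ w = φ g := by
  refine (S.eq_iff _ _).2 (ReflTransGen.mono ?_ _ _ hg)
  rintro _ _ ⟨b, r, t, s, s', hs₁, hs₂, rfl, rfl⟩
  cases b
  · simp [oneRel] at hs₁
  · simp only [oneRel, if_true] at hs₁ hs₂
    exact ⟨a, r, t, s, s', hG ▸ hs₁, hG ▸ hs₂, rfl, rfl⟩

theorem family_symm {u v w g : List α} (hg : g ∈ family u v w) : w ∈ family u v g :=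
  reflTransGen_rstep_symm hg

theorem family_trans {u v w g h : List α} (hg : g ∈ family u v w) (hh : h ∈ family u v g) :
    h ∈ family u v w :=
  ReflTransGen.trans hg hh

theorem family_finite {G : Bool → Set (List α)} (S : IsPresentation G φ) {a : Bool}
    {u v w : List α} (hG : G a = {u, v}) (hu : u ≠ []) (hv : v ≠ [])
    (hw : SFClass φ (φ w)) : (family u v w).Finite := by
  have S₁ := isPresentation_wordClass (oneRel u v)
  have hf : ∀ y, wordClass (oneRel u v) y = wordClass (oneRel u v) w → y ∈ family u v w :=
    fun y hy => (S₁.eq_iff w y).1 hy.symm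
  refine ((S₁.isTame_oneRel hu hv).finite_class w ?_).subset ?_
  · intro x hx
    exact hw x (family_subset S hG (hf x hx)).symm
  · intro y hy
    exact ((S₁.eq_iff w y).2 hy).symm

/-- The sides of the first relation, and the words obtained from the sides of the second one by
applying the first. -/
def saturated (u₁ v₁ u₂ v₂ : List α) (a : Bool) : Set (List α) :=
  if a then {u₁, v₁} else family u₁ v₁ u₂ ∪ family u₁ v₁ v₂

/-- Saturation gives `replace` for the second family, and `hN` makes it vacuous for the first. For
`overlap`, two of three words come from the same side, and by `family_append` words from the same
side have the same common part. -/
theorem IsPresentation.isTame_saturated {u₁ v₁ u₂ v₂ : List α}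
    (S : IsPresentation (twoRel u₁ v₁ u₂ v₂) φ) (h₁ : u₁ ≠ v₁) (h₂ : u₂ ≠ v₂)
    (hφ : ∀ z, φ z = 1 → z = [])
    (hN : ∀ z ∈ ({u₁, v₁} : Set (List α)), ∀ g ∈ family u₁ v₁ u₂ ∪ family u₁ v₁ v₂, ¬ g <:+: z) :
    IsTame (saturated u₁ v₁ u₂ v₂) φ := by
  have hG : twoRel u₁ v₁ u₂ v₂ true = {u₁, v₁} := by simp [twoRel]
  have e₁ : φ u₁ = φ v₁ := S.congr (a := true) (by simp [twoRel]) (by simp [twoRel])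
  have e₂ : φ u₂ = φ v₂ := S.congr (a := false) (by simp [twoRel]) (by simp [twoRel])
  have hfam : ∀ g ∈ family u₁ v₁ u₂ ∪ family u₁ v₁ v₂, φ g = φ u₂ := by
    rintro g (hg | hg)
    · exact (family_subset S hG hg).symm
    · rw [e₂, family_subset S hG hg]
  have hpair : ∀ z ∈ ({u₁, v₁} : Set (List α)), φ z = φ u₁ := by
    rintro z (rfl | rfl)
    · rfl
    · exact e₁.symm
  have hu₁ : φ u₁ ≠ 1 := fun h => h₁ ((hφ _ h).trans (hφ _ (e₁ ▸ h)).symm)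
  have hu₂ : φ u₂ ≠ 1 := fun h => h₂ ((hφ _ h).trans (hφ _ (e₂ ▸ h)).symm)
  have S' : IsPresentation (saturated u₁ v₁ u₂ v₂) φ := by
    refine S.of_generators (fun a => ⟨a, ?_⟩) ?_
    · cases a
      · rintro _ (rfl | rfl)
        · exact Or.inl .refl
        · exact Or.inr .refl
      · exact subset_rfl
    · intro a z z' hz hz'
      cases a
      · exact (hfam z hz).trans (hfam z' hz').symm
      · exact (hpair z hz).trans (hpair z' hz').symm
  have hG' : saturated u₁ v₁ u₂ v₂ true = {u₁, v₁} := by simp [saturated]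
  have huniq : ∀ w d₁ c₁ e₁ d₂ c₂ e₂ : List α, d₁ ++ c₁ ∈ family u₁ v₁ w →
      d₂ ++ c₂ ∈ family u₁ v₁ w → c₁ ++ e₁ ∈ saturated u₁ v₁ u₂ v₂ true →
      c₂ ++ e₂ ∈ saturated u₁ v₁ u₂ v₂ true → e₁ ≠ [] →
      SFClass φ (φ d₁ * φ c₁ * φ e₁) → SFClass φ (φ d₂ * φ c₂ * φ e₂) → c₁ = c₂ := by
    intro w d₁ c₁ e₁ d₂ c₂ e₂ hd₁ hd₂ hc₁ hc₂ he₁ hs₁ hs₂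
    obtain ⟨d, hd, hφd⟩ := family_append S' hG' hc₁ he₁ hs₁ (family_trans (family_symm hd₁) hd₂)
    exact S'.overlap_unique hd.symm hc₁ (hφd ▸ hs₁) hc₂ hs₂
  refine { S' with ne_nil := ?_, replace := ?_, overlap := ?_, finite := ?_ }
  · rintro a z hz rfl
    cases a
    · exact hu₂ ((hfam _ hz).symm.trans S'.nil)
    · exact hu₁ ((hpair _ hz).symm.trans S'.nil)
  · intro a s z z' t h hz hz' _
    cases a
    · have hst : RStep (oneRel u₁ v₁) (s ++ z ++ t) (s ++ z' ++ t) :=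
        ⟨true, s, t, z, z', hz, hz', rfl, rfl⟩
      rcases h with h | h
      · exact Or.inl (ReflTransGen.tail h hst)
      · exact Or.inr (ReflTransGen.tail h hst)
    · exact (hN _ h z hz ⟨s, t, rfl⟩).elim
  · intro b d₁ c₁ e₁ d₂ c₂ e₂ d₃ c₃ e₃ hd₁ hc₁ he₁ hs₁ hd₂ hc₂ he₂ hs₂ hd₃ hc₃ he₃ hs₃
    cases b
    · have h12 := fun w h h' => huniq w d₁ c₁ e₁ d₂ c₂ e₂ h h' hc₁ hc₂ he₁ hs₁ hs₂
      have h13 := fun w h h' => huniq w d₁ c₁ e₁ d₃ c₃ e₃ h h' hc₁ hc₃ he₁ hs₁ hs₃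
      have h23 := fun w h h' => huniq w d₂ c₂ e₂ d₃ c₃ e₃ h h' hc₂ hc₃ he₂ hs₂ hs₃
      rcases hd₁ with h | h <;> rcases hd₂ with h' | h' <;> rcases hd₃ with h'' | h'' <;>
        first
        | exact Or.inl (h12 _ h h')
        | exact Or.inr (Or.inl (h13 _ h h''))
        | exact Or.inr (Or.inr (h23 _ h' h''))
    · have h12 := fun h => S'.overlap_unique (d₁ := d₁) (d₂ := d₂) h hc₁ hs₁ hc₂ hs₂
      have h13 := fun h => S'.overlap_unique (d₁ := d₁) (d₂ := d₃) h hc₁ hs₁ hc₃ hs₃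
      have h23 := fun h => S'.overlap_unique (d₁ := d₂) (d₂ := d₃) h hc₂ hs₂ hc₃ hs₃
      rcases hd₁ with h | h <;> rcases hd₂ with h' | h' <;> rcases hd₃ with h'' | h'' <;>
        first
        | exact Or.inl (h12 (h.trans h'.symm))
        | exact Or.inr (Or.inl (h13 (h.trans h''.symm)))
        | exact Or.inr (Or.inr (h23 (h'.trans h''.symm)))
  · intro a
    cases a
    · by_cases hs : SFClass φ (φ u₂)
      · have hne : u₁ ≠ [] := fun h => hu₁ (h ▸ S.nil)
        have hne' : v₁ ≠ [] := fun h => hu₁ (e₁.trans (h ▸ S.nil))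
        refine ((family_finite S hG hne hne' hs).union
          (family_finite S hG hne hne' (e₂ ▸ hs))).subset ?_
        exact fun z hz => hz.1
      · refine Set.finite_empty.subset ?_
        rintro z ⟨hz, hsz⟩
        exact hs (hfam z hz ▸ hsz)
    · exact (Set.toFinite ({u₁, v₁} : Set (List α))).subset fun z hz => hz.1

/-- When all sides are equal in the quotient, a square-free side contains no other side properly,
and no proper overlap exists. -/
theorem IsPresentation.isTame_const {F : Set (List α)} (S : IsPresentation (fun _ => F) φ)
    (hF : F.Finite) (hne : ∀ z ∈ F, z ≠ []) : IsTame (fun _ => F) φ where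
  toIsPresentation := S
  ne_nil _ := hne
  replace a s z z' t h hz hz' hs := by
    have h1 : s = [] := S.not_prefix (a := a) (m := z ++ t) hs hz h (by simp) [] t (by
      simp [S.append, S.nil, mul_assoc])
    have h2 : t = [] := S.not_suffix (a := a) (m := s ++ z) hs hz h rfl s [] (by
      simp [S.append, S.nil, mul_assoc])
    subst h1 h2
    simpa using hz'
  overlap b d₁ c₁ e₁ _ _ _ _ _ _ h1 h2 he hs := by
    refine (he (S.not_suffix (a := b) hs h1 h2 rfl [] [] ?_)).elim
    simp [S.append, S.nil]
  finite _ := hF.subset fun z hz => hz.1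

theorem IsPresentation.finite_class_twoRel {u₁ v₁ u₂ v₂ : List α}
    (S : IsPresentation (twoRel u₁ v₁ u₂ v₂) φ) (h₁ : u₁ ≠ v₁) (h₂ : u₂ ≠ v₂) (w : List α)
    (hw : SFClass φ (φ w)) : {y | φ y = φ w}.Finite := by
  have hφ : ∀ z, φ z = 1 → z = [] := by
    intro z hz
    -- A nonempty word equal to the identity could be inserted twice.
    exact hw (w ++ z ++ z) (by simp [S.append, hz]) w z [] (by simp)
  have e₁ : φ u₁ = φ v₁ := S.congr (a := true) (by simp [twoRel]) (by simp [twoRel])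
  have e₂ : φ u₂ = φ v₂ := S.congr (a := false) (by simp [twoRel]) (by simp [twoRel])
  have S' : IsPresentation (twoRel u₂ v₂ u₁ v₁) φ := by
    refine S.of_generators (fun a => ⟨!a, by cases a <;> exact subset_rfl⟩) ?_
    intro a z z' hz hz'
    exact S.congr (a := !a) (by cases a <;> exact hz) (by cases a <;> exact hz')
  by_cases hN : ∀ z ∈ ({u₁, v₁} : Set (List α)), ∀ g ∈ family u₁ v₁ u₂ ∪ family u₁ v₁ v₂,
      ¬ g <:+: z
  · exact (S.isTame_saturated h₁ h₂ hφ hN).finite_class w hw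
  by_cases hN' : ∀ z ∈ ({u₂, v₂} : Set (List α)), ∀ g ∈ family u₂ v₂ u₁ ∪ family u₂ v₂ v₁,
      ¬ g <:+: z
  · exact (S'.isTame_saturated h₂ h₁ hφ hN').finite_class w hw
  push Not at hN hN'
  obtain ⟨z, hz, g, hg, p, q, hpq⟩ := hN
  obtain ⟨z', hz', g', hg', p', q', hpq'⟩ := hN'
  have key : ∀ {u₁ v₁ u₂ v₂ : List α}, IsPresentation (twoRel u₁ v₁ u₂ v₂) φ → φ u₁ = φ v₁ →
      φ u₂ = φ v₂ → ∀ z ∈ ({u₁, v₁} : Set (List α)), ∀ g ∈ family u₁ v₁ u₂ ∪ family u₁ v₁ v₂,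
      φ z = φ u₁ ∧ φ g = φ u₂ := by
    rintro u₁ v₁ u₂ v₂ S e₁ e₂ z hz g hg
    constructor
    · rcases hz with rfl | rfl
      · rfl
      · exact e₁.symm
    · have hG : twoRel u₁ v₁ u₂ v₂ true = {u₁, v₁} := by simp [twoRel]
      rcases hg with hg | hg
      · exact (family_subset S hG hg).symm
      · rw [e₂, family_subset S hG hg]
  obtain ⟨hzu, hgu⟩ := key S e₁ e₂ z hz g hg
  obtain ⟨hzu', hgu'⟩ := key S' e₂ e₁ z' hz' g' hg'
  have f₁ : φ u₁ = φ p * φ u₂ * φ q := by rw [← hzu, ← hpq, ← hgu, S.append, S.append]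
  have f₂ : φ u₂ = φ p' * φ u₁ * φ q' := by rw [← hzu', ← hpq', ← hgu', S.append, S.append]
  -- Now `u₁` equals `p ++ p' ++ u₁ ++ q' ++ q`; iterating twice gives squares unless all four outer
  -- words are empty.
  by_cases hs : SFClass φ (φ u₁)
  · have hpp : p ++ p' = [] := by
      refine hs (p ++ p' ++ p ++ p' ++ u₁ ++ q' ++ q ++ q' ++ q) ?_ [] (p ++ p')
        (u₁ ++ q' ++ q ++ q' ++ q) (by simp)
      conv_rhs => rw [f₁, f₂, f₁, f₂]
      simp [S.append, mul_assoc]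
    have hqq : q' ++ q = [] := by
      refine hs (p ++ p' ++ p ++ p' ++ u₁ ++ q' ++ q ++ q' ++ q) ?_ (p ++ p' ++ p ++ p' ++ u₁)
        (q' ++ q) [] (by simp)
      conv_rhs => rw [f₁, f₂, f₁, f₂]
      simp [S.append, mul_assoc]
    have he : φ u₁ = φ u₂ := by
      rw [f₁, (List.append_eq_nil_iff.1 hpp).1, (List.append_eq_nil_iff.1 hqq).2]
      simp [S.nil]
    have hF : ∀ z ∈ ({u₁, v₁, u₂, v₂} : Set (List α)), φ z = φ u₁ := by
      rintro z (rfl | rfl | rfl | rfl)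
      · rfl
      · exact e₁.symm
      · exact he.symm
      · exact (he.trans e₂).symm
    have S₀ : IsPresentation (fun _ => {u₁, v₁, u₂, v₂}) φ := by
      refine S.of_generators (fun a => ⟨a, ?_⟩) fun a z z' hz hz' =>
        (hF z hz).trans (hF z' hz').symm
      cases a
      · rintro z (rfl | rfl) <;> simp
      · rintro z (rfl | rfl) <;> simp
    refine (S₀.isTame_const (Set.toFinite _) ?_).finite_class w hw
    rintro z hz rfl
    have h1 : φ u₁ = 1 := (hF _ hz).symm.trans S.nil
    exact h₁ ((hφ _ h1).trans (hφ _ (e₁ ▸ h1)).symm)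
  -- The class of `u₁`, and hence that of `u₂`, contains a word with a square, so no side can occur
  -- in `w`.
  · refine (Set.finite_singleton w).subset ?_
    intro y hy
    rcases ReflTransGen.cases_head ((S.eq_iff w y).1 hy.symm) with h | ⟨c, h, -⟩
    · exact h.symm
    · obtain ⟨a, r, t, s, s', hs₁, -, rfl, -⟩ := h
      have hss : SFClass φ (φ s) := S.sf_mid (p := r) (s := t) hw (by simp only [S.append])
      refine (hs ?_).elim
      cases a
      · have : φ s = φ u₂ := by
          rcases hs₁ with rfl | rfl
          · rfl
          · exact e₂.symm
        rw [this, f₂] at hss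
        exact S.sf_mid hss rfl
      · rcases hs₁ with rfl | rfl
        · exact hss
        · rwa [e₁]

end TwoRelations

/-! ### The search and its computability. -/

section Decision

variable {α : Type*}

/-- All the results of replacing one occurrence of `u` in `x` by `v`. -/
def replaceAll [DecidableEq α] (u v x : List α) : List (List α) :=
  (List.range (x.length + 1)).flatMap fun i =>
    if (x.drop i).take u.length = u then [x.take i ++ v ++ (x.drop i).drop u.length] else []

theorem mem_replaceAll [DecidableEq α] {u v x y : List α} :
    y ∈ replaceAll u v x ↔ ∃ r s, x = r ++ u ++ s ∧ y = r ++ v ++ s := by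
  simp only [replaceAll, List.mem_flatMap, List.mem_range]
  constructor
  · rintro ⟨i, -, hi⟩
    split_ifs at hi with h
    · refine ⟨x.take i, (x.drop i).drop u.length, ?_, by simpa using hi⟩
      have hd := List.take_append_drop u.length (x.drop i)
      rw [h] at hd
      rw [List.append_assoc, hd, List.take_append_drop]
    · simp at hi
  · rintro ⟨r, s, rfl, rfl⟩
    exact ⟨r.length, by simp, by simp⟩

/-- The results of one application of a defining relation to `x`. -/
def successors [DecidableEq α] (u₁ v₁ u₂ v₂ x : List α) : List (List α) :=
  replaceAll u₁ v₁ x ++ replaceAll v₁ u₁ x ++ (replaceAll u₂ v₂ x ++ replaceAll v₂ u₂ x)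

/-- The words reached from `x` by at most `n` applications of a defining relation. -/
def reachable [DecidableEq α] (u₁ v₁ u₂ v₂ x : List α) (n : ℕ) : List (List α) :=
  n.rec [x] fun _ L => L ++ L.flatMap (successors u₁ v₁ u₂ v₂)

theorem mem_successors [DecidableEq α] {u₁ v₁ u₂ v₂ x y : List α}
    (h : y ∈ successors u₁ v₁ u₂ v₂ x) : RStep (twoRel u₁ v₁ u₂ v₂) x y := by
  simp only [successors, List.mem_append, mem_replaceAll] at h
  rcases h with (⟨r, s, hx, hy⟩ | ⟨r, s, hx, hy⟩) | (⟨r, s, hx, hy⟩ | ⟨r, s, hx, hy⟩)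
  · exact ⟨true, r, s, _, _, by simp [twoRel], by simp [twoRel], hx, hy⟩
  · exact ⟨true, r, s, _, _, by simp [twoRel], by simp [twoRel], hx, hy⟩
  · exact ⟨false, r, s, _, _, by simp [twoRel], by simp [twoRel], hx, hy⟩
  · exact ⟨false, r, s, _, _, by simp [twoRel], by simp [twoRel], hx, hy⟩

/-- The alternative `y = x` is needed because `RStep` allows a side to be replaced by itself. -/
theorem RStep.mem_successors [DecidableEq α] {u₁ v₁ u₂ v₂ x y : List α}
    (h : RStep (twoRel u₁ v₁ u₂ v₂) x y) : y = x ∨ y ∈ successors u₁ v₁ u₂ v₂ x := by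
  simp only [successors, List.mem_append, mem_replaceAll]
  obtain ⟨a, r, s, z, z', hz, hz', rfl, rfl⟩ := h
  cases a <;> rcases hz with rfl | rfl <;> rcases hz' with rfl | rfl
  · exact Or.inl rfl
  · exact Or.inr (Or.inr (Or.inl ⟨r, s, rfl, rfl⟩))
  · exact Or.inr (Or.inr (Or.inr ⟨r, s, rfl, rfl⟩))
  · exact Or.inl rfl
  · exact Or.inl rfl
  · exact Or.inr (Or.inl (Or.inl ⟨r, s, rfl, rfl⟩))
  · exact Or.inr (Or.inl (Or.inr ⟨r, s, rfl, rfl⟩))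
  · exact Or.inl rfl

theorem mem_reachable_succ [DecidableEq α] {u₁ v₁ u₂ v₂ x y : List α} {n : ℕ} :
    y ∈ reachable u₁ v₁ u₂ v₂ x (n + 1) ↔ y ∈ reachable u₁ v₁ u₂ v₂ x n ∨
      ∃ z ∈ reachable u₁ v₁ u₂ v₂ x n, y ∈ successors u₁ v₁ u₂ v₂ z := by
  change y ∈ reachable u₁ v₁ u₂ v₂ x n ++ _ ↔ _
  rw [List.mem_append, List.mem_flatMap]
  exact Iff.rfl

theorem reachable_mono [DecidableEq α] (u₁ v₁ u₂ v₂ x : List α) {m n : ℕ} (h : m ≤ n) :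
    reachable u₁ v₁ u₂ v₂ x m ⊆ reachable u₁ v₁ u₂ v₂ x n := by
  induction h with
  | refl => exact List.Subset.refl _
  | step _ ih => exact fun y hy => mem_reachable_succ.2 (Or.inl (ih hy))

theorem reflTransGen_of_mem_reachable [DecidableEq α] {u₁ v₁ u₂ v₂ x : List α} {n : ℕ} :
    ∀ {y}, y ∈ reachable u₁ v₁ u₂ v₂ x n → ReflTransGen (RStep (twoRel u₁ v₁ u₂ v₂)) x y := by
  induction n with
  | zero =>
    intro y hy
    rw [List.mem_singleton.1 hy]
  | succ n ih =>
    intro y hy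
    rcases mem_reachable_succ.1 hy with h | ⟨z, hz, h⟩
    · exact ih h
    · exact (ih hz).tail (mem_successors h)

theorem exists_mem_reachable [DecidableEq α] {u₁ v₁ u₂ v₂ x y : List α}
    (h : ReflTransGen (RStep (twoRel u₁ v₁ u₂ v₂)) x y) :
    ∃ n, y ∈ reachable u₁ v₁ u₂ v₂ x n := by
  induction h with
  | refl => exact ⟨0, List.mem_singleton.2 rfl⟩
  | tail _ hs ih =>
    obtain ⟨n, hn⟩ := ih
    rcases hs.mem_successors with rfl | h
    · exact ⟨n, hn⟩
    · exact ⟨n + 1, mem_reachable_succ.2 (Or.inr ⟨_, hn, h⟩)⟩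

/-- The search from `x` may stop at depth `n`: all words are found, or one with a square. -/
def SearchDone [DecidableEq α] (u₁ v₁ u₂ v₂ x : List α) (n : ℕ) : Prop :=
  (∀ y ∈ reachable u₁ v₁ u₂ v₂ x (n + 1), y ∈ reachable u₁ v₁ u₂ v₂ x n) ∨
    ¬ ∀ y ∈ reachable u₁ v₁ u₂ v₂ x n, NoSquare y

/-- If the class is square-free it is finite, so one depth reaches all of it; otherwise a word with
a square is reached at some depth. -/
theorem exists_searchDone [DecidableEq α] {u₁ v₁ u₂ v₂ : List α} (h₁ : u₁ ≠ v₁) (h₂ : u₂ ≠ v₂)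
    (x : List α) : ∃ n, SearchDone u₁ v₁ u₂ v₂ x n := by
  have S := isPresentation_wordClass (twoRel u₁ v₁ u₂ v₂)
  by_cases hx : SFClass (wordClass (twoRel u₁ v₁ u₂ v₂)) (wordClass (twoRel u₁ v₁ u₂ v₂) x)
  · have hex : ∀ y, ∃ n, wordClass (twoRel u₁ v₁ u₂ v₂) y = wordClass (twoRel u₁ v₁ u₂ v₂) x →
        y ∈ reachable u₁ v₁ u₂ v₂ x n := by
      intro y
      by_cases hy : wordClass (twoRel u₁ v₁ u₂ v₂) y = wordClass (twoRel u₁ v₁ u₂ v₂) x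
      · obtain ⟨n, hn⟩ := exists_mem_reachable ((S.eq_iff _ _).1 hy.symm)
        exact ⟨n, fun _ => hn⟩
      · exact ⟨0, fun h => (hy h).elim⟩
    choose f hf using hex
    obtain ⟨n, hn⟩ := ((S.finite_class_twoRel h₁ h₂ x hx).image f).bddAbove
    refine ⟨n, Or.inl fun y hy => ?_⟩
    have hy' := ((S.eq_iff _ _).2 (reflTransGen_of_mem_reachable hy)).symm
    exact reachable_mono _ _ _ _ _ (hn ⟨y, hy', rfl⟩) (hf y hy')
  · simp only [SFClass, not_forall] at hx
    obtain ⟨y, hy, hsq⟩ := hx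
    obtain ⟨n, hn⟩ := exists_mem_reachable ((S.eq_iff _ _).1 hy.symm)
    exact ⟨n, Or.inr fun h => hsq (h y hn)⟩

theorem SearchDone.noSquare_iff [DecidableEq α] {u₁ v₁ u₂ v₂ x : List α} {n : ℕ}
    (h : SearchDone u₁ v₁ u₂ v₂ x n) : (∀ y ∈ reachable u₁ v₁ u₂ v₂ x n, NoSquare y) ↔
      ∀ y, ReflTransGen (RStep (twoRel u₁ v₁ u₂ v₂)) x y → NoSquare y := by
  refine ⟨fun hn y hy => ?_, fun hn y hy => hn y (reflTransGen_of_mem_reachable hy)⟩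
  have hcl := h.resolve_right (not_not.2 hn)
  refine hn y ?_
  induction hy with
  | refl => exact reachable_mono _ _ _ _ _ (Nat.zero_le n) (List.mem_singleton.2 rfl)
  | tail _ hs ih =>
    rcases hs.mem_successors with rfl | hs
    · exact ih
    · exact hcl _ (mem_reachable_succ.2 (Or.inr ⟨_, ih, hs⟩))

/-- Squares are indexed by position and half-length, so the quantifiers are bounded. The length
condition discards equalities caused by truncation. -/
theorem noSquare_iff (x : List α) : NoSquare x ↔
    ∀ i ∈ List.range (x.length + 1), ∀ l ∈ List.range (x.length + 1),
      (x.drop i).take l = ((x.drop i).drop l).take l → (x.drop i).length < l + l ∨ l = 0 := by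
  constructor
  · intro h i _ l _ he
    by_contra! hc
    have := h (x.take i) ((x.drop i).take l) (((x.drop i).drop l).drop l) (by
      have hd := List.take_append_drop l ((x.drop i).drop l)
      rw [← he] at hd
      rw [List.append_assoc, List.append_assoc, hd, List.take_append_drop,
        List.take_append_drop])
    have := congrArg List.length this
    simp only [List.length_take, List.length_nil] at this
    omega
  · rintro h p s q rfl
    have := h p.length (by simp) s.length (by simp; omega) (by simp)
    simp only [List.append_assoc, List.drop_left, List.length_append] at this
    rw [← List.length_eq_zero_iff]
    omega

theorem equalRelativeTo_iff {A : Set α} {u₁ v₁ u₂ v₂ : List α}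
    (hπ : IsDefiningSystem A {(u₁, v₁), (u₂, v₂)}) {w : List α} (hw : w ∈ wordsOver A)
    (y : List α) : (y ∈ wordsOver A ∧ EqualRelativeTo A {(u₁, v₁), (u₂, v₂)} w y) ↔
      ReflTransGen (RStep (twoRel u₁ v₁ u₂ v₂)) w y := by
  have h₁ := hπ.words u₁ v₁ (by simp)
  have h₂ := hπ.words u₂ v₂ (by simp)
  constructor
  · rintro ⟨-, h⟩
    refine ReflTransGen.mono ?_ _ _ h
    rintro _ _ ⟨r, -, s, -, u, -, v, -, rfl, rfl, h⟩
    simp only [Set.mem_insert_iff, Set.mem_singleton_iff, Prod.mk.injEq] at h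
    rcases h with (⟨rfl, rfl⟩ | ⟨rfl, rfl⟩) | (⟨rfl, rfl⟩ | ⟨rfl, rfl⟩)
    · exact ⟨true, r, s, _, _, by simp [twoRel], by simp [twoRel], rfl, rfl⟩
    · exact ⟨false, r, s, _, _, by simp [twoRel], by simp [twoRel], rfl, rfl⟩
    · exact ⟨true, r, s, _, _, by simp [twoRel], by simp [twoRel], rfl, rfl⟩
    · exact ⟨false, r, s, _, _, by simp [twoRel], by simp [twoRel], rfl, rfl⟩
  · intro h
    induction h with
    | refl => exact ⟨hw, .refl⟩
    | tail _ hs ih =>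
      obtain ⟨hb, hwb⟩ := ih
      obtain ⟨a, r, s, z, z', hz, hz', rfl, rfl⟩ := hs
      have hr : r ∈ wordsOver A := fun a ha => hb a (by simp [ha])
      have hs : s ∈ wordsOver A := fun a ha => hb a (by simp [ha])
      have key : z' ∈ wordsOver A ∧ z ∈ wordsOver A ∧
          (z = z' ∨ (z, z') ∈ ({(u₁, v₁), (u₂, v₂)} : Set (List α × List α)) ∨
            (z', z) ∈ ({(u₁, v₁), (u₂, v₂)} : Set (List α × List α))) := by
        cases a <;> rcases hz with rfl | rfl <;> rcases hz' with rfl | rfl <;> simp [h₁, h₂]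
      obtain ⟨hz', hz, he⟩ := key
      refine ⟨?_, ?_⟩
      · intro a ha
        simp only [List.mem_append] at ha
        rcases ha with (ha | ha) | ha
        · exact hr a ha
        · exact hz' a ha
        · exact hs a ha
      · rcases he with rfl | he
        · exact hwb
        · exact hwb.tail ⟨r, hr, s, hs, z, hz, z', hz', rfl, rfl, he⟩

theorem mem_squareFreeWords_iff {A : Set α} {w : List α} (hw : w ∈ wordsOver A) :
    w ∈ squareFreeWords A ↔ NoSquare w := by
  constructor
  · rintro ⟨-, h⟩ p s q rfl
    refine h p ?_ s ?_ q ?_ rfl <;> exact fun a ha => hw a (by simp [ha])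
  · exact fun h => ⟨hw, fun u _ s _ v _ he => h u s v he⟩

theorem mem_relSquareFreeWords_iff {A : Set α} {u₁ v₁ u₂ v₂ : List α}
    (hπ : IsDefiningSystem A {(u₁, v₁), (u₂, v₂)}) (w : List α) :
    w ∈ relSquareFreeWords A {(u₁, v₁), (u₂, v₂)} ↔ w ∈ wordsOver A ∧
      ∀ y, ReflTransGen (RStep (twoRel u₁ v₁ u₂ v₂)) w y → NoSquare y := by
  refine and_congr_right fun hw => forall_congr' fun y => ?_
  rw [← equalRelativeTo_iff hπ hw y]
  exact forall_congr' fun hy => mem_squareFreeWords_iff hy.1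

variable [Primcodable α]

theorem primrecPred_noSquare : PrimrecPred (NoSquare : List α → Prop) := by
  classical
  have h0 : PrimrecRel fun (l : ℕ) (p : ℕ × List α) =>
      (p.2.drop p.1).take l = ((p.2.drop p.1).drop l).take l →
        (p.2.drop p.1).length < l + l ∨ l = 0 := by
    have hd : Primrec fun q : ℕ × ℕ × List α => q.2.2.drop q.2.1 :=
      Primrec.list_drop.comp (Primrec.fst.comp Primrec.snd) (Primrec.snd.comp Primrec.snd)
    have h1 : PrimrecPred fun q : ℕ × ℕ × List α =>
        (q.2.2.drop q.2.1).take q.1 = ((q.2.2.drop q.2.1).drop q.1).take q.1 :=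
      Primrec.eq.comp (Primrec.list_take.comp Primrec.fst hd)
        (Primrec.list_take.comp Primrec.fst (Primrec.list_drop.comp Primrec.fst hd))
    have h2 : PrimrecPred fun q : ℕ × ℕ × List α =>
        (q.2.2.drop q.2.1).length < q.1 + q.1 :=
      Primrec.nat_lt.comp (Primrec.list_length.comp hd)
        (Primrec.nat_add.comp Primrec.fst Primrec.fst)
    have h3 : PrimrecPred fun q : ℕ × ℕ × List α => q.1 = 0 :=
      Primrec.eq.comp Primrec.fst (Primrec.const 0)
    exact (h1.not.or (h2.or h3)).of_eq fun q => imp_iff_not_or.symm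
  have hr : Primrec fun x : List α => List.range (x.length + 1) :=
    Primrec.list_range.comp (Primrec.succ.comp Primrec.list_length)
  have h1 : PrimrecRel fun (i : ℕ) (x : List α) => ∀ l ∈ List.range (x.length + 1),
      (x.drop i).take l = ((x.drop i).drop l).take l → (x.drop i).length < l + l ∨ l = 0 :=
    h0.forall_mem_list.comp (hr.comp Primrec.snd) Primrec.id
  exact (h1.forall_mem_list.comp hr Primrec.id).of_eq fun x => (noSquare_iff x).symm

theorem primrec_replaceAll [DecidableEq α] (u v : List α) :
    Primrec (replaceAll u v) := by
  refine Primrec.list_flatMap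
    (Primrec.list_range.comp (Primrec.succ.comp Primrec.list_length)) ?_
  have hd : Primrec fun p : List α × ℕ => p.1.drop p.2 :=
    Primrec.list_drop.comp Primrec.snd Primrec.fst
  refine Primrec.ite ?_ ?_ (Primrec.const [])
  · exact Primrec.eq.comp (Primrec.list_take.comp (Primrec.const _) hd) (Primrec.const _)
  · refine Primrec.list_cons.comp (Primrec.list_append.comp (Primrec.list_append.comp
      (Primrec.list_take.comp Primrec.snd Primrec.fst) (Primrec.const _))
      (Primrec.list_drop.comp (Primrec.const _) hd)) (Primrec.const [])

theorem primrec_reachable [DecidableEq α] (u₁ v₁ u₂ v₂ : List α) :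
    Primrec₂ (reachable u₁ v₁ u₂ v₂) := by
  have hs : Primrec (successors u₁ v₁ u₂ v₂) :=
    Primrec.list_append.comp
      (Primrec.list_append.comp (primrec_replaceAll _ _) (primrec_replaceAll _ _))
      (Primrec.list_append.comp (primrec_replaceAll _ _) (primrec_replaceAll _ _))
  refine Primrec.nat_rec (f := fun x : List α => [x])
    (g := fun _ p => p.2 ++ p.2.flatMap (successors u₁ v₁ u₂ v₂))
    (Primrec.list_cons.comp Primrec.id (Primrec.const [])) ?_
  have h2 : Primrec fun q : List α × ℕ × List (List α) => q.2.2 :=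
    Primrec.snd.comp Primrec.snd
  exact Primrec.list_append.comp h2 (Primrec.list_flatMap h2 (hs.comp Primrec.snd))

theorem primrecPred_searchDone [DecidableEq α] (u₁ v₁ u₂ v₂ : List α) :
    PrimrecPred fun p : List α × ℕ => SearchDone u₁ v₁ u₂ v₂ p.1 p.2 := by
  have hr : Primrec fun p : List α × ℕ => reachable u₁ v₁ u₂ v₂ p.1 p.2 :=
    primrec_reachable u₁ v₁ u₂ v₂
  have hr' : Primrec fun p : List α × ℕ => reachable u₁ v₁ u₂ v₂ p.1 (p.2 + 1) :=
    (primrec_reachable u₁ v₁ u₂ v₂).comp Primrec.fst (Primrec.succ.comp Primrec.snd)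
  have hmem : PrimrecRel fun (y : List α) (L : List (List α)) => y ∈ L := by
    have h : PrimrecRel fun (L : List (List α)) (y : List α) => ∃ a ∈ L, a = y :=
      PrimrecRel.exists_mem_list Primrec.eq
    exact (h.comp Primrec.snd Primrec.fst).of_eq fun p => by simp
  exact (hmem.forall_mem_list.comp hr' hr).or (primrecPred_noSquare.forall_mem_list.comp hr).not

theorem computablePred_wordsOver {A : Set α} (hA : IsRecursiveSet A) :
    ComputablePred fun w : List α => w ∈ wordsOver A := by
  classical
  -- As `A` need not be primitive recursive, the bounded quantifier is replaced by a search for the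
  -- first index that is out of range or carries a letter outside `A`. It equals the length exactly
  -- when all letters are in `A`.
  have hP : ComputablePred fun p : List α × ℕ => ∀ a, p.1[p.2]? = some a → a ∉ A := by
    obtain ⟨_, hf⟩ := hA
    refine Computable.computablePred ?_
    refine (Computable.option_casesOn (o := fun p : List α × ℕ => p.1[p.2]?)
      (f := fun _ => true) (g := fun _ a => !decide (a ∈ A)) ?_ (Computable.const true) ?_).of_eq ?_
    · exact Primrec.list_getElem?.to_comp
    · exact Primrec.not.to_comp.comp (hf.comp Computable.snd)
    · intro p
      cases h : p.1[p.2]? <;> simp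
  have hex : ∀ w : List α, ∃ n, ∀ a, w[n]? = some a → a ∉ A := fun w => ⟨w.length, by simp⟩
  have hfind := Computable.find (P := fun w n => ∀ a, w[n]? = some a → a ∉ A) hP hex
  have heq : ComputablePred fun p : ℕ × ℕ => p.1 = p.2 := Primrec.eq.computablePred
  refine (Computable.computablePred (p := fun w => Nat.find (hex w) = w.length)
    ((heq.decide.comp (hfind.pair Primrec.list_length.to_comp)))).of_eq ?_
  intro w
  rw [Nat.find_eq_iff]
  constructor
  · rintro ⟨-, h⟩ a ha
    obtain ⟨n, hn, rfl⟩ := List.getElem_of_mem ha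
    have := h n hn
    simpa [hn] using this
  · intro h
    refine ⟨by simp, fun n hn => ?_⟩
    simpa [hn] using h _ (List.getElem_mem hn)

end Decision

theorem mainTheorem2 {α : Type*} [Primcodable α] (A : Set α) (hne : A.Nonempty)
    (hA : IsRecursiveSet A) (u₁ v₁ u₂ v₂ : List α)
    (hπ : IsDefiningSystem A {(u₁, v₁), (u₂, v₂)}) :
    IsRecursiveSet (relSquareFreeWords A {(u₁, v₁), (u₂, v₂)}) := by
  classical
  have h₁ : u₁ ≠ v₁ := by
    rintro rfl
    exact hπ.irrefl u₁ (by simp)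
  have h₂ : u₂ ≠ v₂ := by
    rintro rfl
    exact hπ.irrefl u₂ (by simp)
  have hex := exists_searchDone (α := α) h₁ h₂
  have hfind := Computable.find (P := SearchDone u₁ v₁ u₂ v₂)
    (primrecPred_searchDone u₁ v₁ u₂ v₂).computablePred hex
  have hsq : ComputablePred fun p : List α × ℕ =>
      ∀ y ∈ reachable u₁ v₁ u₂ v₂ p.1 p.2, NoSquare y :=
    (primrecPred_noSquare.forall_mem_list.comp (primrec_reachable u₁ v₁ u₂ v₂)).computablePred
  have hcomp := Primrec.and.to_comp.comp (computablePred_wordsOver hA).decide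
    (hsq.decide.comp (Computable.id.pair hfind))
  refine ComputablePred.of_eq (Computable.computablePred (p := fun w => w ∈ wordsOver A ∧
    ∀ y ∈ reachable u₁ v₁ u₂ v₂ w (Nat.find (hex w)), NoSquare y) (hcomp.of_eq ?_)) ?_
  · intro w
    simp
  · intro w
    rw [mem_relSquareFreeWords_iff hπ, (Nat.find_spec (hex w)).noSquare_iff]
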